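/- Let $i\ge 1$, $m=5i$, $e=2^{4i}+2^{3i}+2^{2i}+2^i-1$, and let $\alpha$ be a primitive element of $GF(2^m)$ (a generator of $GF(2^m)^*$). Let $\mathrm{Tr}$ be the trace from $GF(2^m)$ to $GF(2)$ and let $s^\infty=(s_t)_{t\ge 0}$ be the binary sequence $s_t=\mathrm{Tr}((1+\alpha^t)^{e})$. The linear span $\mathbb L_s$ is the smallest positive integer $l$ for which there are $c_0=1,c_1,\dots,c_l\in GF(2)$ with $-c_0s_t=c_1s_{t-1}+\dots+c_ls_{t-l}$ for all $t\ge l$; for $l=\mathbb L_s$ these $c_j$ are unique, and $\mathbb M_s(x)=c_0+c_1x+\dots+c_lx^l$ is the minimal polynomial of $s^\infty$. Identify an integer $0\le y<2^m-1$, $y=\sum_{j=0}^{m-1}y_j2^j$ with $y_j\in\{0,1\}$, with its binary sequence $y_{m-1}\cdots y_1y_0$, and let $\mathcal R=\mathcal R^1\cup\mathcal R^2\cup\mathcal R_4\cup\mathcal R_3\cup\mathcal R_2\cup\mathcal R_1\cup\mathcal R_0\subset\{0,1,\dots,2^m-2\}$, where - $\mathcal R^1=\bigcup_{2\le l\le i,\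 l\equiv i \bmod 2}\mathcal R^1_l$, and $\mathcal R^1_l$ is the set of $y$ with $y_{i-1}=y_{i-l}=1$ and $y_j=0$ for all $j\ge i$ and all $j<i-l$; - $\mathcal R^2$ is the set of $y$ such that $y_j=0$ for all $j\ge i$ with $j\notin\{2i,3i,4i\}$, $y_j=1$ for some $j\in\{2i,3i,4i\}$, and $\#\{0\le j\le i-1: y_j=1\}\ge 2$; - $\mathcal R_4$ is the set of $y$ with $\{j: i\le j\le 5i-1,\ y_j=1\}=\{2i,3i,4i\}$ and $\#\{0\le j\le i-1: y_j=1\}=1$; - $\mathcal R_3$ is the set of $y$ such that $\{j: i\le j\le 5i-1,\ y_j=1\}$ is a two-element subset of $\{2i,3i,4i\}$, $y_0=0$, and $\#\{1\le j\le i-1: y_j=1\}=1$; - $\mathcal R_2=\{2^{4i}+2^{3i},\ 2^{4i}+2^{2i}\}$; - $\mathcal R_1=\{1\}$ if $i$ is even and $\mathcal R_1=\emptyset$ if $i$ is odd; - $\mathcal R_0=\emptyset$ if $i$ is even and $\mathcal R_0=\{0\}$ if $i$ is odd. Then $$\mathbb L_s=\begin{cases} m\left[\frac{22}{3}(2^i-1)-3i\right],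 & i \text{ even},\\ m\left[\frac{22}{3}(2^i-2)-3i+6\right]+1, & i\text{ odd},\end{cases}$$ and $$\mathbb M_s(x)=\begin{cases}\prod_{k\in\mathcal R}m_{\alpha^{-k}}(x), & i\text{ even},\\ (x-1)\prod_{k\in\mathcal R,\ k\ne 0}m_{\alpha^{-k}}(x), & i\text{ odd},\end{cases}$$ where $m_{\alpha^{-k}}(x)$ is the minimal polynomial of $\alpha^{-k}$ over $GF(2)$. -/

import Mathlib

open Polynomial

namespace DobbertinSequence

/-- The polynomial `c = c₀ + c₁ x + ⋯ + c_l x^l` with `c₀ = 1` encodes a linear recurrence of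
length `l` satisfied by `s`: `-c₀ s_t = c₁ s_{t-1} + ⋯ + c_l s_{t-l}` for all `t ≥ l`. -/
def HasRecurrence {K : Type*} [Field K] (s : ℕ → K) (l : ℕ) (c : K[X]) : Prop :=
  c.natDegree ≤ l ∧ c.coeff 0 = 1 ∧
    ∀ t : ℕ, l ≤ t → -(c.coeff 0 * s t) = ∑ j ∈ Finset.Icc 1 l, c.coeff j * s (t - j)

/-- `l` is the linear span of `s`: the smallest positive length of a linear recurrence of `s`. -/
def IsLinearSpan {K : Type*} [Field K] (s : ℕ → K) (l : ℕ) : Prop :=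
  IsLeast {k : ℕ | 0 < k ∧ ∃ c : K[X], HasRecurrence s k c} l

/-- `M` is the minimal polynomial of `s`: the unique polynomial with constant term `1` that
encodes a recurrence of `s` whose length is the linear span of `s`. -/
def IsMinimalPolynomial {K : Type*} [Field K] (s : ℕ → K) (M : K[X]) : Prop :=
  ∃ l : ℕ, IsLinearSpan s l ∧ ∀ c : K[X], HasRecurrence s l c ↔ c = M

/-- The exponent `e = 2^{4i} + 2^{3i} + 2^{2i} + 2^i - 1` (the subtraction never truncates). -/
def dobbertinExp (i : ℕ) : ℕ := 2 ^ (4 * i) + 2 ^ (3 * i) + 2 ^ (2 * i) + 2 ^ i - 1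

/-- The sequence `s_t = Tr((1 + α^t)^e)`, with the trace from `F` to `GF(2)`. -/
noncomputable def dobbertinSeq {F : Type*} [Field F] [Algebra (ZMod 2) F] (i : ℕ) (α : F) :
    ℕ → ZMod 2 :=
  fun t => Algebra.trace (ZMod 2) F ((1 + α ^ t) ^ dobbertinExp i)

/-- The binary sequences of length `m = 5i` other than the all-ones sequence, identified with the
integers `0 ≤ y < 2^{5i} - 1` (`y.testBit j` says that the `j`-th entry, of weight `2^j`, is `1`). -/
def St (i : ℕ) : Finset ℕ := Finset.range (2 ^ (5 * i) - 1)

/-- The positions in `[a, b)` at which `y` has a one. -/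
def ones (a b y : ℕ) : Finset ℕ := (Finset.Ico a b).filter fun j => y.testBit j = true

/-- The sequences `0…0 (4i zeros) | 1 * ⋯ * 1 (l entries) | 0…0 (i - l zeros)`. -/
def R1l (i l : ℕ) : Finset ℕ :=
  (St i).filter fun y =>
    y.testBit (i - 1) = true ∧ y.testBit (i - l) = true ∧ ones 0 (5 * i) y ⊆ Finset.Ico (i - l) i

/-- The union of the `R1l i l` over `2 ≤ l ≤ i` with `l ≡ i mod 2`. -/
def RUpper1 (i : ℕ) : Finset ℕ :=
  ((Finset.Icc 2 i).filter fun l => l ≡ i [MOD 2]).biUnion (R1l i)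

/-- At positions `≥ i` ones occur only at `2i, 3i, 4i`, at least one occurs there, and there are at
least two ones at positions `< i`. -/
def RUpper2 (i : ℕ) : Finset ℕ :=
  (St i).filter fun y =>
    ones i (5 * i) y ⊆ {2 * i, 3 * i, 4 * i} ∧ (ones i (5 * i) y).Nonempty ∧
      2 ≤ (ones 0 i y).card

/-- Ones at all of `2i, 3i, 4i`, and exactly one further one, at a position `< i`. -/
def RLower4 (i : ℕ) : Finset ℕ :=
  (St i).filter fun y =>
    ones i (5 * i) y = {2 * i, 3 * i, 4 * i} ∧ (ones 0 i y).card = 1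

/-- Ones at exactly two of `2i, 3i, 4i`, and exactly one further one, at a position in
`{1, …, i - 1}`. -/
def RLower3 (i : ℕ) : Finset ℕ :=
  (St i).filter fun y =>
    ones i (5 * i) y ⊆ {2 * i, 3 * i, 4 * i} ∧ (ones i (5 * i) y).card = 2 ∧
      y.testBit 0 = false ∧ (ones 1 i y).card = 1

/-- The two sequences with ones exactly at `4i, 3i`, respectively exactly at `4i, 2i`. -/
def RLower2 (i : ℕ) : Finset ℕ := {2 ^ (4 * i) + 2 ^ (3 * i), 2 ^ (4 * i) + 2 ^ (2 * i)}

/-- The sequence `0…01` if `i` is even, nothing if `i` is odd. -/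
def RLower1 (i : ℕ) : Finset ℕ := if Even i then {1} else ∅

/-- The zero sequence if `i` is odd, nothing if `i` is even. -/
def RLower0 (i : ℕ) : Finset ℕ := if Even i then ∅ else {0}

/-- The explicit set of exponents `R`. -/
def R (i : ℕ) : Finset ℕ :=
  RUpper1 i ∪ RUpper2 i ∪ RLower4 i ∪ RLower3 i ∪ RLower2 i ∪ RLower1 i ∪ RLower0 i

end DobbertinSequence

namespace DobbertinSequence

/-! Since `2^i - 1` is the sum of the `2^j` with `j < i`, the exponent `e` has binary ones exactly
at `0, …, i-1, 2i, 3i, 4i`. In characteristic two `(1+x)^e` is therefore the product of the `1 +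
x^(2^j)` over these positions, that is, the sum of `x^y` over all `y` whose ones lie among them
(`one_add_pow_dobbertinExp`).

After taking traces, `T y = Tr (x^y)` is unchanged when the `5i`-bit word of `y` is rotated, so
terms in one rotation class cancel in pairs. The cancellation uses only the four properties in
`IsCyclic`, and what survives is the sum over `R i` (`IsCyclic.sum_eq_sum_R`).

No two distinct nonzero members of `R i` are rotations of each other, and none is fixed by a proper
rotation (`IsShape.eq_zero_of_isShift`). Expanding each trace into conjugates thus writes `s_t` as a
sum of `β^t` over pairwise distinct `β = α^(k * 2^r)`. When `0` belongs to `R i`, which happens for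
`i` odd, `Tr 1 = 1` contributes the single `β = 1`.

For such a sum, independence of characters shows that a polynomial of degree at most `l` with
constant term `1` encodes a recurrence of length `l` exactly when it vanishes at every `β⁻¹`
(`hasRecurrence_iff`). The minimal polynomial is then the product of the distinct minimal
polynomials of the `α^(-k)`, and the linear span is its degree, computed from `three_mul_card_R`. -/

/-! ### Recurrences of sums of geometric sequences. -/

theorem eq_zero_of_sum_mul_pow {F : Type*} [Field F] (J : Finset F) (d : F → F)
    (h : ∀ t : ℕ, ∑ β ∈ J, d β * β ^ t = 0) : ∀ β ∈ J, d β = 0 := by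
  have hli : LinearIndependent F (fun β : F => (powersHom F β : Multiplicative ℕ → F)) :=
    (linearIndependent_monoidHom (Multiplicative ℕ) F).comp (powersHom F)
      (powersHom F).injective
  refine linearIndependent_iff'.1 hli J d ?_
  funext t
  simpa [Finset.sum_apply] using h t.toAdd

/-- The defect of the recurrence at time `t` equals the sum of `c(β⁻¹) * β^t` over `J`, and distinct
geometric sequences are linearly independent. -/
theorem hasRecurrence_iff {K F : Type*} [Field K] [Field F] [Algebra K F] (J : Finset F)
    (hJ : ∀ β ∈ J, β ≠ 0) (s : ℕ → K) (hs : ∀ t, algebraMap K F (s t) = ∑ β ∈ J, β ^ t)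
    (l : ℕ) (c : K[X]) :
    HasRecurrence s l c ↔
      c.natDegree ≤ l ∧ c.coeff 0 = 1 ∧ ∀ β ∈ J, aeval β⁻¹ c = 0 := by
  unfold HasRecurrence
  refine and_congr_right fun hdeg => and_congr_right fun _ => ?_
  have key : ∀ t, l ≤ t →
      algebraMap K F (c.coeff 0 * s t + ∑ j ∈ Finset.Icc 1 l, c.coeff j * s (t - j)) =
        ∑ β ∈ J, aeval β⁻¹ c * β ^ t := by
    intro t ht
    have h1 : c.coeff 0 * s t + ∑ j ∈ Finset.Icc 1 l, c.coeff j * s (t - j) =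
        ∑ j ∈ Finset.range (l + 1), c.coeff j * s (t - j) := by
      rw [Finset.range_eq_Ico, Finset.sum_eq_sum_Ico_succ_bot (Nat.succ_pos l), tsub_zero]
      rfl
    rw [h1, map_sum]
    simp_rw [map_mul, hs, Finset.mul_sum]
    rw [Finset.sum_comm]
    refine Finset.sum_congr rfl fun β hβ => ?_
    rw [aeval_eq_sum_range' (Nat.lt_succ_of_le hdeg), Finset.sum_mul]
    refine Finset.sum_congr rfl fun j hj => ?_
    have hj' : j ≤ t := by have := Finset.mem_range.1 hj; omega
    rw [Algebra.smul_def, mul_assoc, inv_pow, pow_sub₀ _ (hJ β hβ) hj', mul_comm (β ^ t)]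
  constructor
  · intro h β hβ
    -- The defect is known to vanish only from time `l` on; the shift puts the nonzero factor `β^l`
    -- into the coefficients.
    have := eq_zero_of_sum_mul_pow J (fun β => aeval β⁻¹ c * β ^ l) (fun t => by
      have h2 := key (l + t) (by omega)
      rw [← h (l + t) (by omega)] at h2
      simp only [add_neg_cancel, map_zero] at h2
      rw [h2]
      exact Finset.sum_congr rfl fun β _ => by ring) β hβ
    exact (mul_eq_zero.1 this).resolve_right (pow_ne_zero _ (hJ β hβ))
  · intro h t ht
    have h2 := key t ht
    rw [Finset.sum_eq_zero (s := J) fun β hβ => by rw [h β hβ, zero_mul],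
      map_eq_zero_iff _ (algebraMap K F).injective] at h2
    exact neg_eq_of_add_eq_zero_right h2

theorem isLinearSpan_and_isMinimalPolynomial {K F : Type*} [Field K] [Field F] [Algebra K F]
    (J : Finset F) (hJ : ∀ β ∈ J, β ≠ 0) (s : ℕ → K)
    (hs : ∀ t, algebraMap K F (s t) = ∑ β ∈ J, β ^ t) (M : K[X]) (hM0 : M.coeff 0 = 1)
    (hMpos : 0 < M.natDegree) (hM : ∀ c : K[X], (∀ β ∈ J, aeval β⁻¹ c = 0) ↔ M ∣ c) :
    IsLinearSpan s M.natDegree ∧ IsMinimalPolynomial s M := by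
  have hrec : ∀ l c, HasRecurrence s l c ↔ c.natDegree ≤ l ∧ c.coeff 0 = 1 ∧ M ∣ c := by
    intro l c
    rw [hasRecurrence_iff J hJ s hs, hM]
  have hne : ∀ c : K[X], c.coeff 0 = 1 → c ≠ 0 := by
    rintro c hc rfl
    simp at hc
  have hspan : IsLinearSpan s M.natDegree := by
    refine ⟨⟨hMpos, M, (hrec _ _).2 ⟨le_rfl, hM0, dvd_rfl⟩⟩, ?_⟩
    rintro k ⟨-, c, hc⟩
    obtain ⟨h1, h2, h3⟩ := (hrec _ _).1 hc
    exact (natDegree_le_of_dvd h3 (hne c h2)).trans h1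
  refine ⟨hspan, M.natDegree, hspan, fun c => ⟨fun hc => ?_, ?_⟩⟩
  · obtain ⟨h1, h2, d, rfl⟩ := (hrec _ _).1 hc
    -- A recurrence of the minimal length is `M * d`; the degree bound makes `d` constant and the
    -- constant terms make it `1`.
    have hd : d ≠ 0 := by
      rintro rfl
      simp at h2
    rw [natDegree_mul (hne M hM0) hd] at h1
    rw [eq_C_of_natDegree_le_zero (p := d) (by omega)] at h2 ⊢
    rw [mul_coeff_zero, hM0, one_mul, coeff_C_zero] at h2
    rw [h2, C_1, mul_one]
  · rintro rfl
    exact (hrec _ _).2 ⟨le_rfl, hM0, dvd_rfl⟩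

theorem isLinearSpan_prod_minpoly {F : Type*} [Field F] [Finite F] [Algebra (ZMod 2) F]
    {ι : Type*} (B : Finset ι) (hB : B.Nonempty) (γ : ι → F) (hγ : ∀ k ∈ B, γ k ≠ 0)
    (hinj : ∀ k ∈ B, ∀ k' ∈ B, minpoly (ZMod 2) (γ k) = minpoly (ZMod 2) (γ k') → k = k')
    (J : Finset F) (hJ : ∀ β ∈ J, β ≠ 0) (s : ℕ → ZMod 2)
    (hs : ∀ t, algebraMap (ZMod 2) F (s t) = ∑ β ∈ J, β ^ t)
    (hJB : ∀ c : (ZMod 2)[X], (∀ β ∈ J, aeval β⁻¹ c = 0) ↔ ∀ k ∈ B, aeval (γ k) c = 0) :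
    IsLinearSpan s (∑ k ∈ B, (minpoly (ZMod 2) (γ k)).natDegree) ∧
      IsMinimalPolynomial s (∏ k ∈ B, minpoly (ZMod 2) (γ k)) := by
  have hint : ∀ x : F, IsIntegral (ZMod 2) x := fun x => Algebra.IsIntegral.isIntegral x
  have hirr : ∀ x : F, Irreducible (minpoly (ZMod 2) x) := fun x => minpoly.irreducible (hint x)
  have hdeg : (∏ k ∈ B, minpoly (ZMod 2) (γ k)).natDegree =
      ∑ k ∈ B, (minpoly (ZMod 2) (γ k)).natDegree :=
    natDegree_prod_of_monic _ _ fun k _ => minpoly.monic (hint _)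
  rw [← hdeg]
  refine isLinearSpan_and_isMinimalPolynomial J hJ s hs _ ?_ ?_ fun c => ?_
  · rw [coeff_zero_prod]
    refine Finset.prod_eq_one fun k hk => ?_
    -- Over `ZMod 2` a nonzero constant term is automatically `1`, so no normalisation is needed.
    have h0 : (minpoly (ZMod 2) (γ k)).coeff 0 ≠ 0 := minpoly.coeff_zero_ne_zero (hint _) (hγ k hk)
    generalize (minpoly (ZMod 2) (γ k)).coeff 0 = x at h0
    revert h0 x
    decide
  · rw [hdeg]
    exact Finset.sum_pos (fun k _ => minpoly.natDegree_pos (hint _)) hB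
  · rw [hJB]
    constructor
    · intro h
      refine Finset.prod_dvd_of_coprime ?_ fun k hk => minpoly.dvd _ _ (h k hk)
      intro k hk k' hk' hne
      refine ((hirr (γ k)).coprime_iff_not_dvd).2 fun hd => hne (hinj k hk k' hk' ?_)
      exact eq_of_monic_of_associated (minpoly.monic (hint _)) (minpoly.monic (hint _))
        ((hirr _).associated_of_dvd (hirr _) hd)
    · intro h k hk
      obtain ⟨d, rfl⟩ := (Finset.dvd_prod_of_mem _ hk).trans h
      rw [map_mul, minpoly.aeval, zero_mul]

/-! ### Binary words and their rotations. -/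

theorem testBit_sum_two_pow (S : Finset ℕ) (k : ℕ) :
    (∑ j ∈ S, 2 ^ j).testBit k = true ↔ k ∈ S := by
  conv_rhs => rw [← Finset.toFinset_bitIndices_sum_two_pow S]
  rw [List.mem_toFinset, Nat.mem_bitIndices]

theorem mem_ones {a b y j : ℕ} : j ∈ ones a b y ↔ (a ≤ j ∧ j < b) ∧ y.testBit j = true := by
  simp [ones]

theorem eq_of_testBit_eq_of_lt {N y z : ℕ} (hy : y < 2 ^ N) (hz : z < 2 ^ N)
    (h : ∀ j < N, (y.testBit j = true ↔ z.testBit j = true)) : y = z := by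
  refine Nat.eq_of_testBit_eq fun j => ?_
  rcases lt_or_ge j N with hj | hj
  · exact Bool.eq_iff_iff.2 (h j hj)
  · rw [Nat.testBit_lt_two_pow (hy.trans_le (Nat.pow_le_pow_right two_pos hj)),
      Nat.testBit_lt_two_pow (hz.trans_le (Nat.pow_le_pow_right two_pos hj))]

theorem ones_sum_two_pow {a b : ℕ} {S : Finset ℕ} : ones a b (∑ j ∈ S, 2 ^ j) =
    S.filter fun j => a ≤ j ∧ j < b := by
  ext j
  rw [mem_ones, testBit_sum_two_pow, Finset.mem_filter, and_comm]

theorem sum_ones_two_pow {N y : ℕ} (hy : y < 2 ^ N) : ∑ j ∈ ones 0 N y, 2 ^ j = y := by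
  conv_rhs => rw [← Finset.sum_toFinset_bitIndices_two_pow y]
  refine Finset.sum_congr ?_ fun _ _ => rfl
  ext j
  rw [mem_ones, List.mem_toFinset, Nat.mem_bitIndices]
  refine ⟨fun h => h.2, fun h => ⟨⟨Nat.zero_le _, ?_⟩, h⟩⟩
  by_contra hj
  rw [Nat.testBit_lt_two_pow (hy.trans_le (Nat.pow_le_pow_right two_pos (not_lt.1 hj)))] at h
  cases h

/-- Multiplication by `2 ^ r` modulo `2 ^ m - 1` rotates binary sequences of length `m`. -/
theorem testBit_of_modEq_mul_two_pow {m r y z : ℕ} (hr : r < m) (hy : y < 2 ^ m - 1)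
    (hz : z < 2 ^ m - 1) (h : z ≡ y * 2 ^ r [MOD 2 ^ m - 1]) (j : ℕ) (hj : j < m) :
    z.testBit j = y.testBit (if r ≤ j then j - r else j + m - r) := by
  obtain ⟨d, rfl⟩ := Nat.exists_eq_add_of_le hr.le
  have hm : 1 ≤ 2 ^ (r + d) := Nat.one_le_two_pow
  have hl : y % 2 ^ d < 2 ^ d := Nat.mod_lt _ (by positivity)
  have hh : y / 2 ^ d < 2 ^ r := by
    rw [Nat.div_lt_iff_lt_mul (by positivity), ← pow_add]
    omega
  -- The explicit rotation: the low `d = m - r` bits move up by `r` and the top `r` bits wrap around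
  -- to the bottom.
  set x := 2 ^ r * (y % 2 ^ d) + y / 2 ^ d with hx
  have hbit : ∀ j < r + d, x.testBit j = y.testBit (if r ≤ j then j - r else j + (r + d) - r) := by
    intro j hj
    rw [hx, Nat.testBit_two_pow_mul_add _ hh]
    split_ifs with h1 h2 h2
    · omega
    · rw [Nat.testBit_div_two_pow]
      congr 1
      omega
    · rw [Nat.testBit_mod_two_pow, decide_eq_true (by omega), Bool.true_and]
    · omega
  have hxlt : x < 2 ^ (r + d) := by
    have : 2 ^ r * (y % 2 ^ d + 1) ≤ 2 ^ r * 2 ^ d := Nat.mul_le_mul_left _ hl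
    rw [pow_add]
    nlinarith
  -- An all-ones rotation would force `y` to be all ones; hence `x` is a reduced residue and must
  -- equal `z`.
  have hxne : x ≠ 2 ^ (r + d) - 1 := by
    intro hxe
    refine hy.ne (eq_of_testBit_eq_of_lt (N := r + d) (by omega) (by omega) fun j hj => ?_)
    have := hbit (if j + r < r + d then j + r else j + r - (r + d)) (by split_ifs <;> omega)
    rw [hxe] at this
    rw [Nat.testBit_two_pow_sub_one] at this ⊢
    have e : (if r ≤ (if j + r < r + d then j + r else j + r - (r + d)) then
        (if j + r < r + d then j + r else j + r - (r + d)) - r else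
        (if j + r < r + d then j + r else j + r - (r + d)) + (r + d) - r) = j := by
      split_ifs <;> omega
    rw [e] at this
    rw [← this]
    simp only [decide_eq_true_eq]
    split_ifs <;> omega
  have hxy : x ≡ y * 2 ^ r [MOD 2 ^ (r + d) - 1] := by
    have h1 : y * 2 ^ r = (2 ^ (r + d) - 1) * (y / 2 ^ d) + x := by
      zify [hm]
      have := Nat.div_add_mod y (2 ^ d)
      zify at this
      rw [hx]
      push_cast
      conv_lhs => rw [← this]
      rw [pow_add]
      ring
    rw [h1]
    simp [Nat.ModEq]
  have hzx : z = x := Nat.ModEq.eq_of_lt_of_lt (h.trans hxy.symm) hz (by omega)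
  rw [hzx, hbit j hj]

/-! ### Words of `R i` have no nontrivial rotation in `R i`. -/

/-- At least two ones at positions `< i`, together with a one at `2i, 3i, 4i` or `i - 1`. -/
def IsLong (i : ℕ) (P : ℕ → Prop) : Prop :=
  ∃ a b, a < b ∧ b < i ∧ P a ∧ P b ∧ (P (2 * i) ∨ P (3 * i) ∨ P (4 * i) ∨ P (i - 1))

/-- At most one one at a position `< i`, in the combinations that occur in `R i`. -/
def IsShort (i : ℕ) (P : ℕ → Prop) : Prop :=
  (∃ a < i, ∀ j < 5 * i, (P j ↔ j = 2 * i ∨ j = 3 * i ∨ j = 4 * i ∨ j = a)) ∨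
  (∃ a < i, 0 < a ∧ ∃ b c, (b = 2 * i ∨ b = 3 * i) ∧ (c = 3 * i ∨ c = 4 * i) ∧ b < c ∧
    ∀ j < 5 * i, (P j ↔ j = b ∨ j = c ∨ j = a)) ∨
  (∀ j < 5 * i, (P j ↔ j = 3 * i ∨ j = 4 * i)) ∨
  (∀ j < 5 * i, (P j ↔ j = 2 * i ∨ j = 4 * i)) ∨
  (∀ j < 5 * i, (P j ↔ j = 0))

/-- The binary sequences that occur in `R i`, except for the zero sequence. -/
def IsShape (i : ℕ) (P : ℕ → Prop) : Prop :=
  (∀ j < 5 * i, P j → j < i ∨ j = 2 * i ∨ j = 3 * i ∨ j = 4 * i) ∧ (IsLong i P ∨ IsShort i P)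

/-- The sequence `P'` is obtained from `P` by a cyclic shift by `r`. -/
def IsShift (i r : ℕ) (P P' : ℕ → Prop) : Prop :=
  (∀ j < 5 * i, P j → P' (if j + r < 5 * i then j + r else j + r - 5 * i)) ∧
  ∀ j < 5 * i, P' j → P (if r ≤ j then j - r else j + 5 * i - r)

theorem IsShift.symm {i r : ℕ} {P P' : ℕ → Prop} (h : IsShift i r P P') (hr : 0 < r)
    (hr5 : r < 5 * i) : IsShift i (5 * i - r) P' P := by
  refine ⟨fun j hj hP => ?_, fun j hj hP => ?_⟩
  · convert h.2 j hj hP using 1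
    split_ifs <;> omega
  · convert h.1 j hj hP using 1
    split_ifs <;> omega

theorem IsShift.support {i r : ℕ} {P P' : ℕ → Prop} (h : IsShift i r P P') (hr5 : r < 5 * i)
    (hs : ∀ j < 5 * i, P' j → j < i ∨ j = 2 * i ∨ j = 3 * i ∨ j = 4 * i) (j : ℕ)
    (hj : j < 5 * i) (hP : P j) :
    (j + r < 5 * i ∧ P' (j + r) ∧
      (j + r < i ∨ j + r = 2 * i ∨ j + r = 3 * i ∨ j + r = 4 * i)) ∨
    (5 * i ≤ j + r ∧ P' (j + r - 5 * i) ∧ (j + r - 5 * i < i ∨ j + r - 5 * i = 2 * i ∨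
      j + r - 5 * i = 3 * i ∨ j + r - 5 * i = 4 * i)) := by
  have h1 := h.1 j hj hP
  split_ifs at h1 with hlt
  · exact Or.inl ⟨hlt, h1, hs _ hlt h1⟩
  · exact Or.inr ⟨not_lt.1 hlt, h1, hs _ (by omega) h1⟩

/-- Two ones less than `i` apart force the rotation to be shorter than `i` in one direction. Such a
rotation moves every mark to a forbidden position, so neither word has marks. The one at `i - 1`
then excludes forward rotation; backward rotation is excluded by the same argument on `P'` if it is
long, and otherwise because `{0}` cannot hold two ones. -/
theorem IsLong.not_isShift {i r : ℕ} {P P' : ℕ → Prop} (hL : IsLong i P) (hP : IsShape i P)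
    (hP' : IsShape i P') (hr : 0 < r) (hr5 : r < 5 * i) : ¬ IsShift i r P P' := by
  intro h
  obtain ⟨a, b, hab, hb, hPa, hPb, hm⟩ := hL
  have ha' := h.support hr5 hP'.1 a (by omega) hPa
  have hb' := h.support hr5 hP'.1 b (by omega) hPb
  -- For `i ≤ r ≤ 4i` both images would lie at or above `i`, hence be two marks less than `i` apart.
  have hbd : r < i ∨ 4 * i < r := by omega
  have hno : ∀ c, (c = 2 * i ∨ c = 3 * i ∨ c = 4 * i) → ¬ P c := by
    intro c hc hPc
    have := h.support hr5 hP'.1 c (by omega) hPc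
    omega
  have hno' : ∀ c, (c = 2 * i ∨ c = 3 * i ∨ c = 4 * i) → ¬ P' c := by
    intro c hc hPc
    have := (h.symm hr hr5).support (by omega) hP.1 c (by omega) hPc
    omega
  have htop : P (i - 1) := by
    rcases hm with hm | hm | hm | hm
    · exact absurd hm (hno _ (by omega))
    · exact absurd hm (hno _ (by omega))
    · exact absurd hm (hno _ (by omega))
    · exact hm
  have htop' := h.support hr5 hP'.1 (i - 1) (by omega) htop
  rcases hP'.2 with ⟨c, d, -, -, -, -, hm'⟩ | hS
  · have htop2 : P' (i - 1) := by
      rcases hm' with hm | hm | hm | hm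
      · exact absurd hm (hno' _ (by omega))
      · exact absurd hm (hno' _ (by omega))
      · exact absurd hm (hno' _ (by omega))
      · exact hm
    have := (h.symm hr hr5).support (by omega) hP.1 (i - 1) (by omega) htop2
    omega
  · rcases hS with ⟨c, -, hS⟩ | ⟨c, -, -, d, e, hd, he, -, hS⟩ | hS | hS | hS
    · exact hno' (2 * i) (by omega) ((hS _ (by omega)).2 (by omega))
    · exact hno' d (by omega) ((hS _ (by omega)).2 (by omega))
    · exact hno' (3 * i) (by omega) ((hS _ (by omega)).2 (by omega))
    · exact hno' (2 * i) (by omega) ((hS _ (by omega)).2 (by omega))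
    · have h1 : a + r = 0 ∨ a + r - 5 * i = 0 ∧ 5 * i ≤ a + r := by
        rcases ha' with ⟨h1, h2, -⟩ | ⟨h1, h2, -⟩
        · exact Or.inl ((hS _ h1).1 h2)
        · exact Or.inr ⟨(hS _ (by omega)).1 h2, h1⟩
      have h2 : b + r = 0 ∨ b + r - 5 * i = 0 ∧ 5 * i ≤ b + r := by
        rcases hb' with ⟨h1, h2, -⟩ | ⟨h1, h2, -⟩
        · exact Or.inl ((hS _ h1).1 h2)
        · exact Or.inr ⟨(hS _ (by omega)).1 h2, h1⟩
      omega

theorem IsShift.card_eq {i r : ℕ} {P P' : ℕ → Prop} (h : IsShift i r P P') (hr5 : r < 5 * i)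
    {S S' : Finset ℕ} (hS : ∀ j < 5 * i, (P j ↔ j ∈ S)) (hS' : ∀ j < 5 * i, (P' j ↔ j ∈ S'))
    (hlt : ∀ j ∈ S, j < 5 * i) (hlt' : ∀ j ∈ S', j < 5 * i) : S.card = S'.card := by
  refine Finset.card_nbij' (fun j => if j + r < 5 * i then j + r else j + r - 5 * i)
    (fun j => if r ≤ j then j - r else j + 5 * i - r) ?_ ?_ ?_ ?_
  · intro j hj
    have := hlt j hj
    exact (hS' _ (by dsimp only; split_ifs <;> omega)).1 (h.1 j this ((hS j this).2 hj))
  · intro j hj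
    have := hlt' j hj
    exact (hS _ (by dsimp only; split_ifs <;> omega)).1 (h.2 j this ((hS' j this).2 hj))
  · intro j hj
    have := hlt j hj
    dsimp only
    split_ifs <;> omega
  · intro j hj
    have := hlt' j hj
    dsimp only
    split_ifs <;> omega

theorem IsShift.exists_image {i r : ℕ} {P P' : ℕ → Prop} (h : IsShift i r P P') (hr5 : r < 5 * i)
    {S S' : Finset ℕ} (hS : ∀ j < 5 * i, (P j ↔ j ∈ S)) (hS' : ∀ j < 5 * i, (P' j ↔ j ∈ S'))
    (hlt : ∀ j ∈ S, j < 5 * i) (j : ℕ) (hj : j ∈ S) :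
    ∃ x ∈ S', j + r = x ∨ j + r = x + 5 * i := by
  have := hlt j hj
  exact ⟨if j + r < 5 * i then j + r else j + r - 5 * i,
    (hS' _ (by split_ifs <;> omega)).1 (h.1 j this ((hS j this).2 hj)), by split_ifs <;> omega⟩

/-- At least one of `2i`, `3i` goes to a mark, so `r` is a multiple of `i`. The image of `a` must
then be a mark, giving `a = 0`, and `{0,2,3,4}` has no translational symmetry modulo `5`. -/
theorem not_exists_image_four {i r a a' : ℕ} (hr : 0 < r) (hr5 : r < 5 * i) (ha : a < i)
    (ha' : a' < i) (h : ∀ j ∈ ({2 * i, 3 * i, 4 * i, a} : Finset ℕ),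
      ∃ x ∈ ({2 * i, 3 * i, 4 * i, a'} : Finset ℕ), j + r = x ∨ j + r = x + 5 * i) : False := by
  obtain ⟨x1, h1, g1⟩ := h (2 * i) (by simp)
  obtain ⟨x2, h2, g2⟩ := h (3 * i) (by simp)
  obtain ⟨x3, h3, g3⟩ := h (4 * i) (by simp)
  obtain ⟨x4, h4, g4⟩ := h a (by simp)
  simp only [Finset.mem_insert, Finset.mem_singleton] at h1 h2 h3 h4
  have hri : r = i ∨ r = 2 * i ∨ r = 3 * i ∨ r = 4 * i := by
    rcases h1 with rfl | rfl | rfl | rfl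
    · omega
    · omega
    · omega
    · rcases h2 with rfl | rfl | rfl | rfl <;> omega
  rcases hri with rfl | rfl | rfl | rfl <;> omega

/-- Again `r` is a multiple of `i`, and `a + r` is then neither a mark nor below `i`, because `0 <
a`. This is where the condition `y_0 = 0` in `RLower3` matters. -/
theorem not_exists_image_three {i r a a' b c b' c' : ℕ} (hr : 0 < r) (hr5 : r < 5 * i)
    (ha : a < i) (ha0 : 0 < a) (ha' : a' < i) (ha0' : 0 < a')
    (hb : b = 2 * i ∨ b = 3 * i) (hc : c = 3 * i ∨ c = 4 * i) (hbc : b < c)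
    (hb' : b' = 2 * i ∨ b' = 3 * i) (hc' : c' = 3 * i ∨ c' = 4 * i)
    (h : ∀ j ∈ ({b, c, a} : Finset ℕ),
      ∃ x ∈ ({b', c', a'} : Finset ℕ), j + r = x ∨ j + r = x + 5 * i) : False := by
  obtain ⟨x1, h1, g1⟩ := h b (by simp)
  obtain ⟨x2, h2, g2⟩ := h c (by simp)
  obtain ⟨x3, h3, g3⟩ := h a (by simp)
  simp only [Finset.mem_insert, Finset.mem_singleton] at h1 h2 h3
  have hri : r = i ∨ r = 2 * i ∨ r = 3 * i ∨ r = 4 * i := by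
    rcases h1 with rfl | rfl | rfl
    · omega
    · omega
    · rcases h2 with rfl | rfl | rfl <;> omega
  rcases hri with rfl | rfl | rfl | rfl <;> omega

theorem not_exists_image_two {i r b c b' c' : ℕ} (hr : 0 < r) (hr5 : r < 5 * i)
    (hb : b = 2 * i ∨ b = 3 * i) (hc : c = 4 * i) (hb' : b' = 2 * i ∨ b' = 3 * i) (hc' : c' = 4 * i)
    (h : ∀ j ∈ ({b, c} : Finset ℕ),
      ∃ x ∈ ({b', c'} : Finset ℕ), j + r = x ∨ j + r = x + 5 * i) : False := by
  obtain ⟨x1, h1, g1⟩ := h b (by simp)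
  obtain ⟨x2, h2, g2⟩ := h c (by simp)
  simp only [Finset.mem_insert, Finset.mem_singleton] at h1 h2
  omega

/-- Records the number of ones, a rotation invariant, so that only short words of equal weight need
comparison. -/
theorem IsShort.exists_finset {i : ℕ} {P : ℕ → Prop} (hi : 0 < i) (hP : IsShort i P) :
    ∃ S : Finset ℕ, (∀ j < 5 * i, (P j ↔ j ∈ S)) ∧ (∀ j ∈ S, j < 5 * i) ∧
      ((S.card = 4 ∧ ∃ a < i, S = {2 * i, 3 * i, 4 * i, a}) ∨
      (S.card = 3 ∧ ∃ a < i, 0 < a ∧ ∃ b c, (b = 2 * i ∨ b = 3 * i) ∧ (c = 3 * i ∨ c = 4 * i) ∧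
        b < c ∧ S = {b, c, a}) ∨
      (S.card = 2 ∧ ∃ b c, (b = 2 * i ∨ b = 3 * i) ∧ c = 4 * i ∧ S = {b, c}) ∨
      (S.card = 1 ∧ S = {0})) := by
  rcases hP with ⟨a, ha, hP⟩ | ⟨a, ha, ha0, b, c, hb, hc, hbc, hP⟩ | hP | hP | hP
  · refine ⟨{2 * i, 3 * i, 4 * i, a}, by simpa using hP, ?_, Or.inl ⟨?_, a, ha, rfl⟩⟩
    · simp only [Finset.mem_insert, Finset.mem_singleton]
      omega
    · repeat rw [Finset.card_insert_of_notMem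
        (by simp only [Finset.mem_insert, Finset.mem_singleton]; omega)]
      rfl
  · refine ⟨{b, c, a}, by simpa using hP, ?_,
      Or.inr (Or.inl ⟨?_, a, ha, ha0, b, c, hb, hc, hbc, rfl⟩)⟩
    · simp only [Finset.mem_insert, Finset.mem_singleton]
      omega
    · repeat rw [Finset.card_insert_of_notMem
        (by simp only [Finset.mem_insert, Finset.mem_singleton]; omega)]
      rfl
  · refine ⟨{3 * i, 4 * i}, by simpa using hP, ?_,
      Or.inr (Or.inr (Or.inl ⟨Finset.card_pair (by omega), _, _, Or.inr rfl, rfl, rfl⟩))⟩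
    simp only [Finset.mem_insert, Finset.mem_singleton]
    omega
  · refine ⟨{2 * i, 4 * i}, by simpa using hP, ?_,
      Or.inr (Or.inr (Or.inl ⟨Finset.card_pair (by omega), _, _, Or.inl rfl, rfl, rfl⟩))⟩
    simp only [Finset.mem_insert, Finset.mem_singleton]
    omega
  · refine ⟨{0}, by simpa using hP, ?_, Or.inr (Or.inr (Or.inr ⟨rfl, rfl⟩))⟩
    simp only [Finset.mem_singleton]
    omega

theorem IsShort.not_isShift {i r : ℕ} {P P' : ℕ → Prop} (hP : IsShort i P)
    (hP' : IsShort i P') (hr : 0 < r) (hr5 : r < 5 * i) : ¬ IsShift i r P P' := by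
  intro h
  obtain ⟨S, hS, hlt, hS2⟩ := hP.exists_finset (by omega)
  obtain ⟨S', hS', hlt', hS2'⟩ := hP'.exists_finset (by omega)
  have hcard := h.card_eq hr5 hS hS' hlt hlt'
  have him := h.exists_image hr5 hS hS' hlt
  rcases hS2 with ⟨hc, a, ha, rfl⟩ | ⟨hc, a, ha, ha0, b, c, hb, hc1, hbc, rfl⟩ |
      ⟨hc, b, c, hb, hc1, rfl⟩ | ⟨hc, rfl⟩ <;>
    rcases hS2' with ⟨hc', a', ha', rfl⟩ | ⟨hc', a', ha', ha0', b', c', hb', hc1', hbc', rfl⟩ |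
      ⟨hc', b', c', hb', hc1', rfl⟩ | ⟨hc', rfl⟩ <;>
    first
    | exact absurd hcard (by rw [hc, hc']; decide)
    | skip
  · exact not_exists_image_four hr hr5 ha ha' him
  · exact not_exists_image_three hr hr5 ha ha0 ha' ha0' hb hc1 hbc hb' hc1' him
  · exact not_exists_image_two hr hr5 hb hc1 hb' hc1' him
  · obtain ⟨x, hx, hx'⟩ := him 0 (by simp)
    rw [Finset.mem_singleton] at hx
    omega

theorem IsShape.eq_zero_of_isShift {i r : ℕ} {P P' : ℕ → Prop} (hP : IsShape i P)
    (hP' : IsShape i P') (hr5 : r < 5 * i) (h : IsShift i r P P') : r = 0 := by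
  by_contra hr
  have hr := Nat.pos_of_ne_zero hr
  rcases hP.2 with hL | hS
  · exact hL.not_isShift hP hP' hr hr5 h
  · rcases hP'.2 with hL' | hS'
    · exact hL'.not_isShift hP' hP (by omega) (by omega) (h.symm hr hr5)
    · exact hS.not_isShift hS' hr hr5 h

/-! ### The pieces of `R i` as products of upper and lower bit patterns. -/

/-- The elements of `St i` whose positions of ones at and above `i` form a member of `𝒲` and
whose positions of ones below `i` form a member of `𝒜`. -/
def blockSet (i : ℕ) (𝒲 𝒜 : Finset (Finset ℕ)) : Finset ℕ :=
  (St i).filter fun y => ones i (5 * i) y ∈ 𝒲 ∧ ones 0 i y ∈ 𝒜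

/-- The positions `2i, 3i, 4i`. -/
abbrev marks (i : ℕ) : Finset ℕ := {2 * i, 3 * i, 4 * i}

theorem mem_St {i y : ℕ} : y ∈ St i ↔ y < 2 ^ (5 * i) - 1 := by
  simp [St]

theorem ones_subset_range {i y : ℕ} : ones 0 i y ⊆ Finset.range i := by
  intro j hj
  exact Finset.mem_range.2 (mem_ones.1 hj).1.2

theorem sum_two_pow_mem_St {i : ℕ} (hi : 1 ≤ i) {S : Finset ℕ}
    (hS : S ⊆ marks i ∪ Finset.range i) : ∑ j ∈ S, 2 ^ j ∈ St i := by
  have hmem : ∀ j ∈ S, j < 5 * i ∧ j ≠ i := by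
    intro j hj
    have := hS hj
    simp only [Finset.mem_union, Finset.mem_insert, Finset.mem_singleton, Finset.mem_range] at this
    omega
  have hlt : ∑ j ∈ S, 2 ^ j < 2 ^ (5 * i) := Nat.geomSum_lt le_rfl fun j hj => (hmem j hj).1
  have hne : ∑ j ∈ S, 2 ^ j ≠ 2 ^ (5 * i) - 1 := by
    intro he
    -- Position `i` is neither a mark nor below `i`, so it witnesses that the word is not all ones.
    have h1 : (∑ j ∈ S, 2 ^ j).testBit i = true := by
      rw [he, Nat.testBit_two_pow_sub_one, decide_eq_true_eq]
      omega
    exact (hmem i ((testBit_sum_two_pow S i).1 h1)).2 rfl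
  rw [mem_St]
  omega

theorem ones_zero_union_ones {i y : ℕ} : ones i (5 * i) y ∪ ones 0 i y = ones 0 (5 * i) y := by
  ext j
  simp only [Finset.mem_union, mem_ones]
  refine ⟨?_, ?_⟩
  · rintro (⟨h1, h2⟩ | ⟨h1, h2⟩) <;> exact ⟨by omega, h2⟩
  · rintro ⟨h1, h2⟩
    rcases lt_or_ge j i with h | h
    · exact Or.inr ⟨by omega, h2⟩
    · exact Or.inl ⟨by omega, h2⟩

theorem sum_blockSet {M : Type*} [AddCommMonoid M] {i : ℕ} (hi : 1 ≤ i)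
    {𝒲 𝒜 : Finset (Finset ℕ)} (h𝒲 : ∀ w ∈ 𝒲, w ⊆ marks i)
    (h𝒜 : ∀ a ∈ 𝒜, a ⊆ Finset.range i) (f : ℕ → M) :
    ∑ y ∈ blockSet i 𝒲 𝒜, f y =
      ∑ w ∈ 𝒲, ∑ a ∈ 𝒜, f (∑ j ∈ w, 2 ^ j + ∑ j ∈ a, 2 ^ j) := by
  have hw : ∀ w ∈ 𝒲, ∀ j ∈ w, i ≤ j ∧ j < 5 * i ∧ ¬ j < i := by
    intro w hw j hj
    have := h𝒲 w hw hj
    simp only [Finset.mem_insert, Finset.mem_singleton] at this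
    omega
  have ha : ∀ a ∈ 𝒜, ∀ j ∈ a, 0 ≤ j ∧ j < i ∧ ¬ i ≤ j := by
    intro a ha j hj
    have := Finset.mem_range.1 (h𝒜 a ha hj)
    omega
  have hunion : ∀ w ∈ 𝒲, ∀ a ∈ 𝒜,
      ∑ j ∈ w, 2 ^ j + ∑ j ∈ a, 2 ^ j = ∑ j ∈ w ∪ a, 2 ^ j := by
    intro w hw' a ha'
    refine (Finset.sum_union (Finset.disjoint_left.2 fun j hj hj' => ?_)).symm
    exact (ha a ha' j hj').2.2 (hw w hw' j hj).1
  have hup : ∀ w ∈ 𝒲, ∀ a ∈ 𝒜, ones i (5 * i) (∑ j ∈ w ∪ a, 2 ^ j) = w := by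
    intro w hw' a ha'
    rw [ones_sum_two_pow]
    ext j
    simp only [Finset.mem_filter, Finset.mem_union]
    refine ⟨?_, fun h => ⟨Or.inl h, (hw w hw' j h).1, (hw w hw' j h).2.1⟩⟩
    rintro ⟨h | h, h'⟩
    · exact h
    · exact absurd h'.1 (ha a ha' j h).2.2
  have hlow : ∀ w ∈ 𝒲, ∀ a ∈ 𝒜, ones 0 i (∑ j ∈ w ∪ a, 2 ^ j) = a := by
    intro w hw' a ha'
    rw [ones_sum_two_pow]
    ext j
    simp only [Finset.mem_filter, Finset.mem_union]
    refine ⟨?_, fun h => ⟨Or.inr h, (ha a ha' j h).1, (ha a ha' j h).2.1⟩⟩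
    rintro ⟨h | h, h'⟩
    · exact absurd h'.2 (hw w hw' j h).2.2
    · exact h
  have hback : ∀ y ∈ blockSet i 𝒲 𝒜,
      ∑ j ∈ ones i (5 * i) y, 2 ^ j + ∑ j ∈ ones 0 i y, 2 ^ j = y := by
    intro y hy
    obtain ⟨hy1, hy2, hy3⟩ := Finset.mem_filter.1 hy
    rw [hunion _ hy2 _ hy3, ones_zero_union_ones, sum_ones_two_pow]
    have := mem_St.1 hy1
    omega
  rw [← Finset.sum_product']
  refine Finset.sum_nbij' (fun y => (ones i (5 * i) y, ones 0 i y))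
    (fun p => ∑ j ∈ p.1, 2 ^ j + ∑ j ∈ p.2, 2 ^ j) ?_ ?_ ?_ ?_ ?_
  · intro y hy
    exact Finset.mem_product.2 (Finset.mem_filter.1 hy).2
  · rintro ⟨w, a⟩ hp
    obtain ⟨hw', ha'⟩ := Finset.mem_product.1 hp
    dsimp only at hw' ha' ⊢
    rw [hunion w hw' a ha']
    refine Finset.mem_filter.2 ⟨sum_two_pow_mem_St hi (Finset.union_subset_union (h𝒲 w hw')
      (h𝒜 a ha')), ?_⟩
    rw [hup w hw' a ha', hlow w hw' a ha']
    exact ⟨hw', ha'⟩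
  · exact hback
  · rintro ⟨w, a⟩ hp
    obtain ⟨hw', ha'⟩ := Finset.mem_product.1 hp
    dsimp only at hw' ha' ⊢
    rw [hunion w hw' a ha', hup w hw' a ha', hlow w hw' a ha']
  · intro y hy
    rw [hback y hy]

theorem RUpper2_eq (i : ℕ) : RUpper2 i = blockSet i ((marks i).powerset.erase ∅)
    ((Finset.range i).powerset.filter fun a => 2 ≤ a.card) := by
  refine Finset.filter_congr fun y _ => ?_
  simp only [Finset.mem_erase, Finset.mem_powerset, Finset.mem_filter, ones_subset_range,
    true_and, ← Finset.nonempty_iff_ne_empty]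
  tauto

theorem RLower4_eq (i : ℕ) : RLower4 i =
    blockSet i {marks i} (Finset.powersetCard 1 (Finset.range i)) := by
  refine Finset.filter_congr fun y _ => ?_
  simp only [Finset.mem_singleton, Finset.mem_powersetCard, ones_subset_range, true_and]

theorem ones_one_eq {i y : ℕ} (h : y.testBit 0 = false) : ones 1 i y = ones 0 i y := by
  ext j
  simp only [mem_ones]
  refine and_congr_left fun hj => ?_
  have : j ≠ 0 := by
    rintro rfl
    rw [h] at hj
    cases hj
  omega

theorem RLower3_eq (i : ℕ) : RLower3 i =
    blockSet i (Finset.powersetCard 2 (marks i)) (Finset.powersetCard 1 (Finset.Ico 1 i)) := by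
  refine Finset.filter_congr fun y _ => ?_
  simp only [Finset.mem_powersetCard, and_assoc]
  refine and_congr_right fun _ => and_congr_right fun _ => ?_
  constructor
  · rintro ⟨h1, h2⟩
    rw [← ones_one_eq h1]
    exact ⟨Finset.filter_subset _ _, h2⟩
  · rintro ⟨h1, h2⟩
    have h0 : y.testBit 0 = false := by
      by_contra h
      rw [Bool.not_eq_false] at h
      obtain ⟨j, hj⟩ := Finset.card_pos.1 (by rw [h2]; exact one_pos)
      have h3 := mem_ones.1 hj
      have := Finset.mem_Ico.1 (h1 (mem_ones.2 ⟨⟨le_rfl, by omega⟩, h⟩))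
      omega
    exact ⟨h0, by rw [ones_one_eq h0]; exact h2⟩

theorem mem_RUpper1 {i y : ℕ} : y ∈ RUpper1 i ↔ y ∈ St i ∧ ∃ l, 2 ≤ l ∧ l ≤ i ∧ l ≡ i [MOD 2] ∧
    y.testBit (i - 1) = true ∧ y.testBit (i - l) = true ∧
      ones 0 (5 * i) y ⊆ Finset.Ico (i - l) i := by
  simp only [RUpper1, Finset.mem_biUnion, Finset.mem_filter, Finset.mem_Icc, R1l]
  constructor
  · rintro ⟨l, ⟨⟨h1, h2⟩, h3⟩, h4, h5⟩
    exact ⟨h4, l, h1, h2, h3, h5⟩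
  · rintro ⟨h4, l, h1, h2, h3, h5⟩
    exact ⟨l, ⟨⟨h1, h2⟩, h3⟩, h4, h5⟩

theorem card_ones_of_mem_RUpper1 {i y : ℕ} (hy : y ∈ RUpper1 i) :
    (ones i (5 * i) y).card = 0 ∧ 2 ≤ (ones 0 i y).card := by
  obtain ⟨-, l, h1, h2, -, h3, h4, h5⟩ := mem_RUpper1.1 hy
  constructor
  · rw [Finset.card_eq_zero, Finset.eq_empty_iff_forall_notMem]
    intro j hj
    rw [mem_ones] at hj
    have := Finset.mem_Ico.1 (h5 (mem_ones.2 ⟨⟨Nat.zero_le _, hj.1.2⟩, hj.2⟩))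
    omega
  · refine Finset.one_lt_card.2 ⟨i - 1, mem_ones.2 ⟨by omega, h3⟩, i - l,
      mem_ones.2 ⟨by omega, h4⟩, by omega⟩

theorem two_pow_add_two_pow {a b : ℕ} (h : a ≠ b) : 2 ^ a + 2 ^ b = ∑ j ∈ {a, b}, 2 ^ j :=
  (Finset.sum_pair h).symm

theorem card_ones_of_mem_RLower2 {i y : ℕ} (hi : 1 ≤ i) (hy : y ∈ RLower2 i) :
    (ones i (5 * i) y).card = 2 ∧ (ones 0 i y).card = 0 := by
  have key : ∀ b, b ≠ 4 * i → i ≤ b → b < 5 * i →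
      (ones i (5 * i) (2 ^ (4 * i) + 2 ^ b)).card = 2 ∧
        (ones 0 i (2 ^ (4 * i) + 2 ^ b)).card = 0 := by
    intro b hb hib hb5
    rw [two_pow_add_two_pow hb.symm, ones_sum_two_pow, ones_sum_two_pow]
    constructor
    · rw [Finset.filter_true_of_mem, Finset.card_pair hb.symm]
      simp only [Finset.mem_insert, Finset.mem_singleton]
      omega
    · rw [Finset.filter_false_of_mem, Finset.card_empty]
      simp only [Finset.mem_insert, Finset.mem_singleton]
      omega
  rcases Finset.mem_insert.1 hy with rfl | hy
  · exact key _ (by omega) (by omega) (by omega)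
  · rw [Finset.mem_singleton.1 hy]
    exact key _ (by omega) (by omega) (by omega)

theorem card_ones_of_mem_RLower1 {i y : ℕ} (hi : 1 ≤ i) (hy : y ∈ RLower1 i) :
    (ones i (5 * i) y).card = 0 ∧ (ones 0 i y).card = 1 := by
  have hy : y = ∑ j ∈ {0}, 2 ^ j := by
    unfold RLower1 at hy
    split_ifs at hy
    · simpa using hy
    · simp at hy
  rw [hy, ones_sum_two_pow, ones_sum_two_pow]
  constructor
  · rw [Finset.filter_false_of_mem, Finset.card_empty]
    simp only [Finset.mem_singleton]
    omega
  · rw [Finset.filter_true_of_mem, Finset.card_singleton]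
    simp only [Finset.mem_singleton]
    omega

theorem card_ones_of_mem_RLower0 {i y : ℕ} (hy : y ∈ RLower0 i) :
    (ones i (5 * i) y).card = 0 ∧ (ones 0 i y).card = 0 := by
  unfold RLower0 at hy
  split_ifs at hy
  · simp at hy
  · rw [Finset.mem_singleton.1 hy]
    simp [ones]

theorem card_ones_of_mem_RUpper2 {i y : ℕ} (hy : y ∈ RUpper2 i) :
    1 ≤ (ones i (5 * i) y).card ∧ 2 ≤ (ones 0 i y).card := by
  obtain ⟨-, -, h1, h2⟩ := Finset.mem_filter.1 hy
  exact ⟨Finset.card_pos.2 h1, h2⟩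

theorem card_marks {i : ℕ} (hi : 1 ≤ i) : (marks i).card = 3 := by
  rw [Finset.card_insert_of_notMem, Finset.card_pair (by omega)]
  simp only [Finset.mem_insert, Finset.mem_singleton]
  omega

theorem card_ones_of_mem_RLower4 {i y : ℕ} (hi : 1 ≤ i) (hy : y ∈ RLower4 i) :
    (ones i (5 * i) y).card = 3 ∧ (ones 0 i y).card = 1 := by
  obtain ⟨-, h1, h2⟩ := Finset.mem_filter.1 hy
  exact ⟨by rw [h1]; exact card_marks hi, h2⟩

theorem card_ones_of_mem_RLower3 {i y : ℕ} (hy : y ∈ RLower3 i) :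
    (ones i (5 * i) y).card = 2 ∧ (ones 0 i y).card = 1 := by
  obtain ⟨-, -, h1, h2, h3⟩ := Finset.mem_filter.1 hy
  exact ⟨h1, by rw [← ones_one_eq h2]; exact h3⟩

/-- The pieces are disjoint because the numbers of ones at or above `i` and below `i` separate them:
`(0,≥2)`, `(≥1,≥2)`, `(3,1)`, `(2,1)`, `(2,0)`, `(0,1)`, `(0,0)`. -/
theorem sum_R {M : Type*} [AddCommMonoid M] {i : ℕ} (hi : 1 ≤ i) (f : ℕ → M) :
    ∑ y ∈ R i, f y = ∑ y ∈ RUpper1 i, f y + ∑ y ∈ RUpper2 i, f y + ∑ y ∈ RLower4 i, f y +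
      ∑ y ∈ RLower3 i, f y + ∑ y ∈ RLower2 i, f y + ∑ y ∈ RLower1 i, f y +
      ∑ y ∈ RLower0 i, f y := by
  unfold R
  repeat rw [Finset.sum_union]
  all_goals
    rw [Finset.disjoint_left]
    intro y hy hy'
    try simp only [Finset.mem_union] at hy
    have h1 := fun h => card_ones_of_mem_RUpper1 (i := i) (y := y) h
    have h2 := fun h => card_ones_of_mem_RUpper2 (i := i) (y := y) h
    have h3 := fun h => card_ones_of_mem_RLower4 (i := i) (y := y) hi h
    have h4 := fun h => card_ones_of_mem_RLower3 (i := i) (y := y) h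
    have h5 := fun h => card_ones_of_mem_RLower2 (i := i) (y := y) hi h
    have h6 := fun h => card_ones_of_mem_RLower1 (i := i) (y := y) hi h
    have h7 := fun h => card_ones_of_mem_RLower0 (i := i) (y := y) h
    grind

theorem mem_R {i y : ℕ} : y ∈ R i ↔ y ∈ RUpper1 i ∨ y ∈ RUpper2 i ∨ y ∈ RLower4 i ∨
    y ∈ RLower3 i ∨ y ∈ RLower2 i ∨ y ∈ RLower1 i ∨ y ∈ RLower0 i := by
  simp only [R, Finset.mem_union, or_assoc]

theorem sum_two_pow_lt {i b : ℕ} (hi : 1 ≤ i) (hb : b ∈ marks i) (hb4 : b ≠ 4 * i) :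
    2 ^ (4 * i) + 2 ^ b ∈ St i := by
  rw [two_pow_add_two_pow hb4.symm]
  refine sum_two_pow_mem_St hi ?_
  intro j hj
  rcases Finset.mem_insert.1 hj with rfl | hj
  · simp
  · rw [Finset.mem_singleton.1 hj]
    exact Finset.mem_union_left _ hb

theorem mem_St_of_mem_R {i y : ℕ} (hi : 1 ≤ i) (hy : y ∈ R i) : y ∈ St i := by
  rcases mem_R.1 hy with h | h | h | h | h | h | h
  · exact (mem_RUpper1.1 h).1
  · exact (Finset.mem_filter.1 h).1
  · exact (Finset.mem_filter.1 h).1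
  · exact (Finset.mem_filter.1 h).1
  · rcases Finset.mem_insert.1 h with rfl | h
    · exact sum_two_pow_lt hi (by simp) (by omega)
    · rw [Finset.mem_singleton.1 h]
      exact sum_two_pow_lt hi (by simp) (by omega)
  · have h1 : y = ∑ j ∈ {0}, 2 ^ j := by
      unfold RLower1 at h
      split_ifs at h
      · simpa using h
      · simp at h
    rw [h1]
    refine sum_two_pow_mem_St hi ?_
    simp only [Finset.singleton_subset_iff, Finset.mem_union, Finset.mem_range]
    omega
  · have h1 : y = ∑ j ∈ ∅, 2 ^ j := by
      unfold RLower0 at h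
      split_ifs at h
      · simp at h
      · simpa using h
    rw [h1]
    exact sum_two_pow_mem_St hi (Finset.empty_subset _)

theorem isShape_of_mem_RLower2 {i y : ℕ} (hi : 1 ≤ i) (hy : y ∈ RLower2 i) :
    IsShape i fun j => y.testBit j = true := by
  have key : ∀ b, b ≠ 4 * i → ∀ j,
      (2 ^ (4 * i) + 2 ^ b).testBit j = true ↔ j = b ∨ j = 4 * i := by
    intro b hb j
    rw [two_pow_add_two_pow hb.symm, testBit_sum_two_pow, Finset.mem_insert,
      Finset.mem_singleton, or_comm]
  have hy : y = 2 ^ (4 * i) + 2 ^ (3 * i) ∨ y = 2 ^ (4 * i) + 2 ^ (2 * i) := by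
    simpa [RLower2] using hy
  rcases hy with hy | hy
  · have k := key (3 * i) (by omega)
    rw [← hy] at k
    refine ⟨fun j _ hj => ?_, Or.inr (Or.inr (Or.inr (Or.inl fun j _ => k j)))⟩
    have := (k j).1 hj
    omega
  · have k := key (2 * i) (by omega)
    rw [← hy] at k
    refine ⟨fun j _ hj => ?_, Or.inr (Or.inr (Or.inr (Or.inr (Or.inl fun j _ => k j))))⟩
    have := (k j).1 hj
    omega

theorem isShape_of_mem_R {i y : ℕ} (hi : 1 ≤ i) (hy : y ∈ R i) (hy0 : y ≠ 0) :
    IsShape i fun j => y.testBit j = true := by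
  have hsup : ones i (5 * i) y ⊆ marks i →
      ∀ j < 5 * i, y.testBit j = true → j < i ∨ j = 2 * i ∨ j = 3 * i ∨ j = 4 * i := by
    intro h j hj hb
    by_cases hji : j < i
    · exact Or.inl hji
    · have := h (mem_ones.2 ⟨⟨not_lt.1 hji, hj⟩, hb⟩)
      simp only [Finset.mem_insert, Finset.mem_singleton] at this
      omega
  have hiff : ∀ W a, ones i (5 * i) y = W → ones 0 i y = {a} →
      ∀ j < 5 * i, (y.testBit j = true ↔ j ∈ W ∨ j = a) := by
    rintro W a rfl ha j hj
    have haj : j = a ↔ j ∈ ones 0 i y := by rw [ha, Finset.mem_singleton]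
    rw [haj, mem_ones, mem_ones]
    constructor
    · intro h
      rcases lt_or_ge j i with h' | h'
      · exact Or.inr ⟨by omega, h⟩
      · exact Or.inl ⟨by omega, h⟩
    · rintro (h | h) <;> exact h.2
  rcases mem_R.1 hy with h | h | h | h | h | h | h
  · obtain ⟨-, l, h1, h2, -, h3, h4, h5⟩ := mem_RUpper1.1 h
    refine ⟨fun j hj hb => Or.inl ?_, Or.inl ⟨i - l, i - 1, by omega, by omega, h4, h3, by tauto⟩⟩
    exact (Finset.mem_Ico.1 (h5 (mem_ones.2 ⟨⟨Nat.zero_le _, hj⟩, hb⟩))).2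
  · obtain ⟨-, h1, ⟨b, hb⟩, h2⟩ := Finset.mem_filter.1 h
    refine ⟨hsup h1, Or.inl ?_⟩
    obtain ⟨c, hc, d, hd, hcd⟩ := Finset.one_lt_card.1 h2
    have hc := mem_ones.1 hc
    have hd := mem_ones.1 hd
    have hb' := (mem_ones.1 hb).2
    have hbm := h1 hb
    simp only [Finset.mem_insert, Finset.mem_singleton] at hbm
    have hm : y.testBit (2 * i) = true ∨ y.testBit (3 * i) = true ∨ y.testBit (4 * i) = true ∨
        y.testBit (i - 1) = true := by
      rcases hbm with rfl | rfl | rfl <;> tauto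
    rcases lt_or_gt_of_ne hcd with h' | h'
    · exact ⟨c, d, h', hd.1.2, hc.2, hd.2, hm⟩
    · exact ⟨d, c, h', hc.1.2, hd.2, hc.2, hm⟩
  · obtain ⟨-, h1, h2⟩ := Finset.mem_filter.1 h
    obtain ⟨a, ha⟩ := Finset.card_eq_one.1 h2
    have hai := (mem_ones.1 (ha.symm ▸ Finset.mem_singleton_self a : a ∈ ones 0 i y)).1.2
    refine ⟨hsup h1.subset, Or.inr (Or.inl ⟨a, hai, fun j hj => ?_⟩)⟩
    refine (hiff _ _ h1 ha j hj).trans ?_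
    simp only [Finset.mem_insert, Finset.mem_singleton, or_assoc]
  · obtain ⟨-, h1, h2, h3, h4⟩ := Finset.mem_filter.1 h
    obtain ⟨a, ha⟩ := Finset.card_eq_one.1 h4
    have hai := (mem_ones.1 (ha.symm ▸ Finset.mem_singleton_self a : a ∈ ones 1 i y)).1
    rw [ones_one_eq h3] at ha
    obtain ⟨b, c, hbc, hW⟩ := Finset.card_eq_two.1 h2
    have hb := h1 (hW.symm ▸ Finset.mem_insert_self b {c} : b ∈ ones i (5 * i) y)
    have hc := h1 (hW.symm ▸ by simp : c ∈ ones i (5 * i) y)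
    simp only [Finset.mem_insert, Finset.mem_singleton] at hb hc
    refine ⟨hsup h1, Or.inr (Or.inr (Or.inl ⟨a, hai.2, hai.1, ?_⟩))⟩
    rcases lt_or_gt_of_ne hbc with h' | h'
    · refine ⟨b, c, by omega, by omega, h', fun j hj => ?_⟩
      refine (hiff _ _ hW ha j hj).trans ?_
      simp only [Finset.mem_insert, Finset.mem_singleton, or_assoc]
    · refine ⟨c, b, by omega, by omega, h', fun j hj => ?_⟩
      refine (hiff _ _ hW ha j hj).trans ?_
      simp only [Finset.mem_insert, Finset.mem_singleton]
      rw [← or_assoc, or_comm (a := j = b)]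
  · exact isShape_of_mem_RLower2 hi h
  · have h1 : y = ∑ j ∈ {0}, 2 ^ j := by
      unfold RLower1 at h
      split_ifs at h
      · simpa using h
      · simp at h
    rw [h1]
    simp only [testBit_sum_two_pow, Finset.mem_singleton]
    exact ⟨fun j _ hj => by omega, Or.inr (Or.inr (Or.inr (Or.inr (Or.inr fun j _ => Iff.rfl))))⟩
  · unfold RLower0 at h
    split_ifs at h
    · simp at h
    · exact absurd (Finset.mem_singleton.1 h) hy0

/-! ### Cyclotomic cosets of the elements of `R i`. -/

/-- The nonzero elements of `R i` have cyclotomic cosets of full size, which are disjoint. -/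
theorem eq_of_modEq_mul_two_pow {i r y z : ℕ} (hi : 1 ≤ i) (hr : r < 5 * i) (hy : y ∈ R i)
    (hy0 : y ≠ 0) (hz : z ∈ R i) (hz0 : z ≠ 0)
    (h : z ≡ y * 2 ^ r [MOD 2 ^ (5 * i) - 1]) : r = 0 ∧ z = y := by
  have hy' := mem_St.1 (mem_St_of_mem_R hi hy)
  have hz' := mem_St.1 (mem_St_of_mem_R hi hz)
  have hrot := testBit_of_modEq_mul_two_pow hr hy' hz' h
  have hr0 : r = 0 := by
    refine (isShape_of_mem_R hi hy hy0).eq_zero_of_isShift (isShape_of_mem_R hi hz hz0) hr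
      ⟨fun j hj hb => ?_, fun j hj hb => ?_⟩
    · dsimp only at hb ⊢
      rw [hrot _ (by split_ifs <;> omega), ← hb]
      congr 1
      split_ifs <;> omega
    · dsimp only at hb ⊢
      rw [← hrot _ hj, hb]
  subst hr0
  rw [pow_zero, mul_one] at h
  exact ⟨rfl, Nat.ModEq.eq_of_lt_of_lt h hz' hy'⟩

theorem coprime_two_pow_sub_one_two_pow {m : ℕ} (hm : m ≠ 0) (k : ℕ) :
    Nat.Coprime (2 ^ m - 1) (2 ^ k) := by
  refine Nat.Coprime.pow_right k (Nat.coprime_two_right.2 ?_)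
  exact Nat.Even.sub_odd Nat.one_le_two_pow (Nat.even_pow.2 ⟨even_two, hm⟩) odd_one

theorem eq_of_mul_two_pow_modEq {i r r' y z : ℕ} (hi : 1 ≤ i) (hr : r < 5 * i) (hr' : r' < 5 * i)
    (hy : y ∈ R i) (hy0 : y ≠ 0) (hz : z ∈ R i) (hz0 : z ≠ 0)
    (h : z * 2 ^ r' ≡ y * 2 ^ r [MOD 2 ^ (5 * i) - 1]) : r' = r ∧ z = y := by
  wlog hle : r' ≤ r generalizing r r' y z
  · have := this hr' hr hz hz0 hy hy0 h.symm (by omega)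
    exact ⟨this.1.symm, this.2.symm⟩
  obtain ⟨d, rfl⟩ := Nat.exists_eq_add_of_le hle
  have h' : z ≡ y * 2 ^ d [MOD 2 ^ (5 * i) - 1] := by
    refine Nat.ModEq.cancel_right_of_coprime (coprime_two_pow_sub_one_two_pow (by omega) r') ?_
    convert h using 1
    ring
  have := eq_of_modEq_mul_two_pow hi (by omega) hy hy0 hz hz0 h'
  exact ⟨by omega, this.2⟩

/-! ### `RUpper1` through 2-adic valuations. -/

theorem testBit_padicValNat {y : ℕ} (hy : y ≠ 0) : y.testBit (padicValNat 2 y) = true ∧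
    ∀ j < padicValNat 2 y, y.testBit j = false := by
  obtain ⟨u, hu⟩ := pow_padicValNat_dvd (p := 2) (n := y)
  have hodd : u % 2 = 1 := by
    by_contra h
    obtain ⟨w, rfl⟩ : 2 ∣ u := by omega
    refine pow_succ_padicValNat_not_dvd (p := 2) hy ⟨w, ?_⟩
    rw [pow_succ, mul_assoc]
    exact hu
  generalize padicValNat 2 y = v at hu
  subst hu
  constructor
  · rw [Nat.testBit_two_pow_mul]
    simp [hodd]
  · intro j hj
    rw [Nat.testBit_two_pow_mul, decide_eq_false (by omega), Bool.false_and]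

theorem eq_padicValNat {y k : ℕ} (hk : y.testBit k = true) (hlow : ∀ j < k, y.testBit j = false) :
    k = padicValNat 2 y := by
  have hy : y ≠ 0 := by
    rintro rfl
    simp at hk
  obtain ⟨h1, h2⟩ := testBit_padicValNat hy
  rcases lt_trichotomy k (padicValNat 2 y) with h | h | h
  · rw [h2 k h] at hk
    cases hk
  · exact h
  · rw [hlow _ h] at h1
    cases h1

/-- The lowest one sits at `i - l = v₂(y)`, so the parity condition on `l` says that `v₂(y)` is
even, and `l ≥ 2` excludes only `2^(i-1)`. -/
theorem mem_RUpper1_iff {i y : ℕ} (hi : 1 ≤ i) : y ∈ RUpper1 i ↔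
    (2 ^ (i - 1) ≤ y ∧ y < 2 ^ i) ∧ Even (padicValNat 2 y) ∧ y ≠ 2 ^ (i - 1) := by
  rw [mem_RUpper1]
  constructor
  · rintro ⟨hS, l, h1, h2, hl, h3, h4, h5⟩
    have hy5 := mem_St.1 hS
    have hout : ∀ j, ¬ (i - l ≤ j ∧ j < i) → y.testBit j = false := by
      intro j hj
      rw [← Bool.not_eq_true]
      intro hb
      rcases lt_or_ge j (5 * i) with h | h
      · exact hj (Finset.mem_Ico.1 (h5 (mem_ones.2 ⟨⟨Nat.zero_le _, h⟩, hb⟩)))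
      · have := Nat.pow_le_pow_right two_pos h
        rw [Nat.testBit_lt_two_pow (by omega)] at hb
        cases hb
    have hv := eq_padicValNat h4 fun j hj => hout j (by omega)
    refine ⟨⟨Nat.ge_two_pow_of_testBit h3, ?_⟩, ?_, ?_⟩
    · exact Nat.lt_pow_two_of_testBit _ fun j hj => hout j (by omega)
    · rw [← hv, Nat.even_iff]
      unfold Nat.ModEq at hl
      omega
    · rintro rfl
      rw [Nat.testBit_two_pow, decide_eq_true_eq] at h4
      omega
  · rintro ⟨⟨h1, h2⟩, hv, hne⟩
    have hpos : 0 < 2 ^ (i - 1) := by positivity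
    have hy0 : y ≠ 0 := by omega
    obtain ⟨hb, hlow⟩ := testBit_padicValNat hy0
    have hle := Nat.ge_two_pow_of_testBit hb
    have hlt : padicValNat 2 y < i := (Nat.pow_lt_pow_iff_right one_lt_two).1 (hle.trans_lt h2)
    have htop : y.testBit (i - 1) = true :=
      Nat.testBit_of_two_pow_le_and_two_pow_add_one_gt h1 (by rwa [Nat.sub_add_cancel hi])
    have hvne : padicValNat 2 y ≠ i - 1 := by
      intro he
      refine hne ?_
      obtain ⟨u, hu⟩ := pow_padicValNat_dvd (p := 2) (n := y)
      rw [he] at hu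
      have h2i : 2 ^ i = 2 ^ (i - 1) * 2 := by rw [← pow_succ, Nat.sub_add_cancel hi]
      rw [h2i, hu] at h2
      have hu2 : u < 2 := lt_of_mul_lt_mul_left h2 (Nat.zero_le _)
      interval_cases u
      · omega
      · omega
    have hll : i - (i - padicValNat 2 y) = padicValNat 2 y := by omega
    refine ⟨?_, i - padicValNat 2 y, by omega, by omega, ?_, htop, ?_, ?_⟩
    · rw [mem_St]
      have h3 : 2 ^ (i + 1) ≤ 2 ^ (5 * i) := Nat.pow_le_pow_right two_pos (by omega)
      rw [pow_succ] at h3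
      omega
    · unfold Nat.ModEq
      rw [Nat.even_iff] at hv
      omega
    · rwa [hll]
    · intro j hj
      rw [hll, Finset.mem_Ico]
      have hj' := (mem_ones.1 hj).2
      constructor
      · by_contra h
        rw [hlow j (by omega)] at hj'
        cases hj'
      · by_contra h
        rw [Nat.testBit_lt_two_pow (h2.trans_le (Nat.pow_le_pow_right two_pos (not_lt.1 h)))] at hj'
        cases hj'

/-- Doubling matches even valuations below `2^k` with odd valuations below `2^(k+1)`. It serves both
the cancellation modulo two and the count. -/
theorem sum_Ico_two_pow_succ {M : Type*} [AddCommMonoid M] (k : ℕ) (f : ℕ → M) :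
    ∑ y ∈ Finset.Ico 1 (2 ^ (k + 1)), f y =
      ∑ y ∈ (Finset.Ico 1 (2 ^ (k + 1))).filter (fun y => Even (padicValNat 2 y)), f y +
        ∑ y ∈ (Finset.Ico 1 (2 ^ k)).filter (fun y => Even (padicValNat 2 y)), f (2 * y) := by
  rw [← Finset.sum_filter_add_sum_filter_not _ (fun y => Even (padicValNat 2 y))]
  congr 1
  have hval : ∀ y, 1 ≤ y → padicValNat 2 (2 * y) = padicValNat 2 y + 1 := by
    intro y hy
    rw [padicValNat.mul two_ne_zero (by omega), padicValNat_self, add_comm]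
  refine (Finset.sum_nbij' (fun y => 2 * y) (fun y => y / 2) ?_ ?_ ?_ ?_ ?_).symm
  · intro y hy
    simp only [Finset.mem_filter, Finset.mem_Ico] at hy ⊢
    rw [hval y hy.1.1, Nat.not_even_iff_odd, pow_succ]
    exact ⟨by omega, hy.2.add_one⟩
  · intro y hy
    simp only [Finset.mem_filter, Finset.mem_Ico] at hy ⊢
    have h2 : 2 ∣ y := by
      by_contra h
      rw [padicValNat.eq_zero_of_not_dvd h] at hy
      exact hy.2 Even.zero
    obtain ⟨z, rfl⟩ := h2
    rw [hval z (by omega), Nat.not_even_iff_odd, pow_succ] at hy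
    rw [Nat.mul_div_cancel_left _ two_pos]
    refine ⟨by omega, ?_⟩
    have := hy.2
    rw [← Nat.not_even_iff_odd, Nat.even_add_one, not_not] at this
    exact this
  · intro y _
    omega
  · intro y hy
    simp only [Finset.mem_filter] at hy
    have h2 : 2 ∣ y := by
      by_contra h
      rw [padicValNat.eq_zero_of_not_dvd h] at hy
      exact hy.2 Even.zero
    omega
  · intro y _
    rfl

theorem sum_RUpper1_add {M : Type*} [AddCommMonoid M] {i : ℕ} (hi : 1 ≤ i) (f : ℕ → M) :
    ∑ y ∈ RUpper1 i, f y + (if Even i then 0 else f (2 ^ (i - 1))) =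
      ∑ y ∈ (Finset.Ico (2 ^ (i - 1)) (2 ^ i)).filter (fun y => Even (padicValNat 2 y)), f y := by
  have hlt : 2 ^ (i - 1) < 2 ^ i := Nat.pow_lt_pow_right one_lt_two (by omega)
  have hv : padicValNat 2 (2 ^ (i - 1)) = i - 1 := padicValNat.prime_pow _
  split_ifs with h
  · rw [add_zero]
    refine Finset.sum_congr ?_ fun _ _ => rfl
    ext y
    rw [mem_RUpper1_iff hi, Finset.mem_filter, Finset.mem_Ico]
    refine ⟨fun h => ⟨h.1, h.2.1⟩, fun h' => ⟨h'.1, h'.2, ?_⟩⟩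
    rintro rfl
    rw [hv, Nat.even_sub hi] at h'
    simp [h] at h'
  · rw [add_comm, ← Finset.sum_insert]
    · refine Finset.sum_congr ?_ fun _ _ => rfl
      ext y
      rw [Finset.mem_insert, mem_RUpper1_iff hi, Finset.mem_filter, Finset.mem_Ico]
      constructor
      · rintro (rfl | h')
        · rw [hv, Nat.even_sub hi]
          simp [h, hlt]
        · exact ⟨h'.1, h'.2.1⟩
      · rintro ⟨h1, h2⟩
        by_cases hy : y = 2 ^ (i - 1)
        · exact Or.inl hy
        · exact Or.inr ⟨h1, h2, hy⟩
    · rw [mem_RUpper1_iff hi]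
      tauto

theorem sum_filter_Ico_succ {M : Type*} [AddCommMonoid M] (k : ℕ) (p : ℕ → Prop) [DecidablePred p]
    (f : ℕ → M) : ∑ y ∈ (Finset.Ico 1 (2 ^ (k + 1))).filter p, f y =
      ∑ y ∈ (Finset.Ico 1 (2 ^ k)).filter p, f y +
        ∑ y ∈ (Finset.Ico (2 ^ k) (2 ^ (k + 1))).filter p, f y := by
  simp only [Finset.sum_filter]
  exact (Finset.sum_Ico_consecutive _ Nat.one_le_two_pow
    (Nat.pow_le_pow_right two_pos (Nat.le_succ k))).symm

/-- Over `ZMod 2`, terms at `y` and `2 * y` cancel, so only `RUpper1` and powers of two remain. -/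
theorem sum_range_two_pow_eq {i : ℕ} (hi : 1 ≤ i) (T : ℕ → ZMod 2) (h2 : ∀ y, T (2 * y) = T y) :
    ∑ y ∈ Finset.range (2 ^ i), T y =
      T 0 + (∑ y ∈ RUpper1 i, T y + if Even i then 0 else T 1) := by
  have hpow : ∀ k, T (2 ^ k) = T 1 := by
    intro k
    induction k with
    | zero => rw [pow_zero]
    | succ k ih => rw [pow_succ', h2, ih]
  have h := sum_RUpper1_add hi T
  rw [hpow] at h
  obtain ⟨k, rfl⟩ := Nat.exists_eq_add_of_le' hi
  rw [h, Finset.range_eq_Ico, Finset.sum_eq_sum_Ico_succ_bot (by positivity),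
    sum_Ico_two_pow_succ, sum_filter_Ico_succ, Nat.add_sub_cancel]
  simp only [h2]
  congr 1
  rw [add_right_comm, CharTwo.add_self_eq_zero, zero_add]

/-- Three times the number of elements of `RUpper1 i`. -/
theorem three_mul_card_RUpper1 {i : ℕ} (hi : 1 ≤ i) :
    3 * (RUpper1 i).card + (if Even i then 1 else 2) = 2 ^ i := by
  -- If `N k` counts even valuations in `[1, 2^k)`, doubling gives `N (k+1) + N k = 2^(k+1) - 1`;
  -- this is its closed form.
  have key : ∀ k, 3 * ((Finset.Ico 1 (2 ^ k)).filter
      fun y => Even (padicValNat 2 y)).card + (if Even k then 2 else 1) = 2 ^ (k + 1) := by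
    intro k
    induction k with
    | zero => simp
    | succ k ih =>
      have h := sum_Ico_two_pow_succ k (fun _ => 1)
      simp only [← Finset.card_eq_sum_ones, Nat.card_Ico] at h
      have hpos : 1 ≤ 2 ^ k := Nat.one_le_two_pow
      rw [pow_succ] at h ih ⊢
      rw [pow_succ]
      by_cases hk : Even k
      · simp only [hk, Nat.even_add_one, if_true, not_true_eq_false, if_false] at ih ⊢
        omega
      · simp only [hk, Nat.even_add_one, if_true, not_false_eq_true, if_false] at ih ⊢
        omega
  have h := sum_RUpper1_add hi (fun _ => 1)
  obtain ⟨k, rfl⟩ := Nat.exists_eq_add_of_le' hi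
  have h' := sum_filter_Ico_succ k (fun y => Even (padicValNat 2 y)) (fun _ => 1)
  simp only [← Finset.card_eq_sum_ones, Nat.add_sub_cancel] at h h'
  have k1 := key k
  have k2 := key (k + 1)
  have p1 : 2 ^ (k + 1) = 2 * 2 ^ k := pow_succ' 2 k
  have p2 : 2 ^ (k + 1 + 1) = 2 * 2 ^ (k + 1) := pow_succ' 2 (k + 1)
  by_cases hk : Even k
  · simp only [hk, Nat.even_add_one, if_true, not_true_eq_false, if_false] at h k1 k2 ⊢
    omega
  · simp only [hk, Nat.even_add_one, if_true, not_false_eq_true, if_false] at h k1 k2 ⊢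
    omega

/-! ### Splitting sums over subsets by cardinality. -/

theorem sum_powerset_range_eq_sum_range {M : Type*} [AddCommMonoid M] (i : ℕ) (f : ℕ → M) :
    ∑ a ∈ (Finset.range i).powerset, f (∑ j ∈ a, 2 ^ j) = ∑ y ∈ Finset.range (2 ^ i), f y := by
  refine Finset.sum_nbij' (fun a => ∑ j ∈ a, 2 ^ j) (fun y => ones 0 i y) ?_ ?_ ?_ ?_ ?_
  · intro a ha
    rw [Finset.mem_powerset] at ha
    exact Finset.mem_range.2 (Nat.geomSum_lt le_rfl fun j hj => Finset.mem_range.1 (ha hj))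
  · intro y _
    exact Finset.mem_powerset.2 ones_subset_range
  · intro a ha
    rw [Finset.mem_powerset] at ha
    rw [ones_sum_two_pow, Finset.filter_true_of_mem]
    exact fun j hj => ⟨Nat.zero_le _, Finset.mem_range.1 (ha hj)⟩
  · intro y hy
    exact sum_ones_two_pow (Finset.mem_range.1 hy)
  · intro a _
    rfl

theorem sum_powersetCard_one {α M : Type*} [AddCommMonoid M] (s : Finset α)
    (g : Finset α → M) : ∑ a ∈ Finset.powersetCard 1 s, g a = ∑ j ∈ s, g {j} := by
  rw [Finset.powersetCard_one, Finset.sum_map]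
  rfl

theorem sum_powerset_eq_of_card {α M : Type*} [AddCommMonoid M] (s : Finset α)
    (g : Finset α → M) : ∑ a ∈ s.powerset, g a =
      g ∅ + ∑ j ∈ s, g {j} + ∑ a ∈ s.powerset.filter (fun a => 2 ≤ a.card), g a := by
  classical
  rw [← Finset.sum_filter_not_add_sum_filter _ (fun a => 2 ≤ a.card)]
  congr 1
  rw [← sum_powersetCard_one, ← Finset.sum_insert]
  · refine Finset.sum_congr ?_ fun _ _ => rfl
    ext a
    simp only [Finset.mem_filter, Finset.mem_powerset, Finset.mem_insert, Finset.mem_powersetCard,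
      ← Finset.card_eq_zero (s := a), not_le]
    constructor
    · rintro ⟨h1, h2⟩
      rcases Nat.eq_zero_or_pos a.card with h | h
      · exact Or.inl h
      · exact Or.inr ⟨h1, by omega⟩
    · rintro (h | h)
      · rw [Finset.card_eq_zero.1 h]
        simp
      · exact ⟨h.1, by omega⟩
  · simp [Finset.mem_powersetCard]

theorem sum_powersetCard_two_triple {α M : Type*} [DecidableEq α] [AddCommMonoid M] {a b c : α}
    (hab : a ≠ b) (hac : a ≠ c) (hbc : b ≠ c) (g : Finset α → M) :
    ∑ w ∈ Finset.powersetCard 2 {a, b, c}, g w = g {a, b} + g {a, c} + g {b, c} := by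
  have h : Finset.powersetCard 2 {a, b, c} = {{a, b}, {a, c}, {b, c}} := by
    rw [Finset.powersetCard_succ_insert (by simp [hab, hac]),
      Finset.powersetCard_succ_insert (by simp [hbc])]
    have h1 : Finset.powersetCard 2 {c} = ∅ := Finset.powersetCard_eq_empty.2 (by simp)
    ext w
    simp only [h1, Finset.powersetCard_one, Finset.mem_union, Finset.mem_image, Finset.mem_map,
      Finset.mem_insert, Finset.mem_singleton, Finset.notMem_empty, false_or,
      Function.Embedding.coeFn_mk]
    grind
  rw [h, Finset.sum_insert, Finset.sum_pair, add_assoc]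
  · intro h
    have : a ∈ ({b, c} : Finset α) := h ▸ Finset.mem_insert_self _ _
    simp [hab, hac] at this
  · simp only [Finset.mem_insert, Finset.mem_singleton, not_or]
    constructor
    · intro h
      have : b ∈ ({a, c} : Finset α) := h ▸ by simp
      simp [hab.symm, hbc] at this
    · intro h
      have : a ∈ ({b, c} : Finset α) := h ▸ by simp
      simp [hab, hac] at this

theorem sum_powerset_erase_triple {α M : Type*} [DecidableEq α] [AddCommMonoid M] {a b c : α}
    (hab : a ≠ b) (hac : a ≠ c) (hbc : b ≠ c) (g : Finset α → M) :
    ∑ w ∈ ({a, b, c} : Finset α).powerset.erase ∅, g w =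
      (g {a} + g {b} + g {c}) + (g {a, b} + g {a, c} + g {b, c}) + g {a, b, c} := by
  rw [← sum_powersetCard_two_triple hab hac hbc, ← Finset.sum_singleton (a := {a, b, c}) (f := g)]
  have h1 : g {a} + g {b} + g {c} = ∑ w ∈ Finset.powersetCard 1 {a, b, c}, g w := by
    rw [sum_powersetCard_one, Finset.sum_insert (by simp [hab, hac]), Finset.sum_pair hbc,
      add_assoc]
  have hc : ({a, b, c} : Finset α).card = 3 := by
    rw [Finset.card_insert_of_notMem (by simp [hab, hac]), Finset.card_pair hbc]
  rw [h1, ← Finset.sum_union, ← Finset.sum_union]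
  · refine Finset.sum_congr ?_ fun _ _ => rfl
    ext w
    simp only [Finset.mem_erase, Finset.mem_powerset, Finset.mem_union, Finset.mem_powersetCard,
      Finset.mem_singleton, ne_eq, ← Finset.card_eq_zero (s := w)]
    constructor
    · rintro ⟨h1, h2⟩
      have h3 := Finset.card_le_card h2
      rw [hc] at h3
      by_cases h4 : w.card = 3
      · exact Or.inr (Finset.eq_of_subset_of_card_le h2 (by omega))
      · refine Or.inl ?_
        by_cases h5 : w.card = 2
        · exact Or.inr ⟨h2, h5⟩
        · exact Or.inl ⟨h2, by omega⟩
    · rintro ((h | h) | h)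
      · exact ⟨by omega, h.1⟩
      · exact ⟨by omega, h.1⟩
      · subst h
        exact ⟨by omega, subset_rfl⟩
  · rw [Finset.disjoint_singleton_right, Finset.mem_union, Finset.mem_powersetCard,
      Finset.mem_powersetCard]
    omega
  · rw [Finset.disjoint_left]
    intro w hw hw'
    have h1 := (Finset.mem_powersetCard.1 hw).2
    have h2 := (Finset.mem_powersetCard.1 hw').2
    omega

/-! ### Cancellation of traces modulo two. -/

/-- The properties of `y ↦ Tr (x ^ y)` that determine which terms cancel. -/
structure IsCyclic (i : ℕ) (T : ℕ → ZMod 2) : Prop where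
  two_mul : ∀ y, T (2 * y) = T y
  period : ∀ k y, T (2 ^ (5 * i + k) + y) = T (2 ^ k + y)
  zero : T 0 = if Even i then 0 else 1
  half : ∀ k, 2 * k = 5 * i → T (2 ^ k + 1) = 0

section Cyclic

variable {i : ℕ} {T : ℕ → ZMod 2}

theorem IsCyclic.two_pow_mul (hT : IsCyclic i T) (k y : ℕ) : T (2 ^ k * y) = T y := by
  induction k with
  | zero => rw [pow_zero, one_mul]
  | succ k ih => rw [pow_succ', mul_assoc, hT.two_mul, ih]

theorem IsCyclic.two_pow (hT : IsCyclic i T) (k : ℕ) : T (2 ^ k) = T 1 := by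
  rw [← mul_one (2 ^ k), hT.two_pow_mul]

theorem IsCyclic.pair (hT : IsCyclic i T) {a b : ℕ} (h : b ≤ a) :
    T (2 ^ a + 2 ^ b) = T (2 ^ (a - b) + 1) := by
  rw [← hT.two_pow_mul b (2 ^ (a - b) + 1), mul_add, ← pow_add, Nat.add_sub_cancel' h, mul_one]

theorem IsCyclic.reflect (hT : IsCyclic i T) {a : ℕ} (h : a ≤ 5 * i) :
    T (2 ^ (5 * i - a) + 1) = T (2 ^ a + 1) := by
  rw [← hT.two_pow_mul a, mul_add, ← pow_add, Nat.add_sub_cancel' h, mul_one]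
  have := hT.period 0 (2 ^ a)
  rw [add_zero, pow_zero] at this
  rw [this, add_comm]

/-- A two-bit term depends only on the gap `g` up to `g ↔ 5i - g`. The three sums run over the gaps
in `(i,2i]`, `(2i,3i]`, `(3i,4i]`. The outer open intervals reflect onto each other, the middle one
onto itself with its possible midpoint killed by `half`, and the endpoints `2i`, `3i` cancel. Only
`4i`, equivalent to `i`, remains. -/
theorem IsCyclic.sum_pairs (hT : IsCyclic i T) (hi : 1 ≤ i) :
    ∑ j ∈ Finset.range i, T (2 ^ (2 * i) + 2 ^ j) + ∑ j ∈ Finset.range i, T (2 ^ (3 * i) + 2 ^ j) +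
      ∑ j ∈ Finset.range i, T (2 ^ (4 * i) + 2 ^ j) = T (2 ^ i + 1) := by
  have hre : ∀ c, 1 ≤ c → ∑ j ∈ Finset.range i, T (2 ^ (c * i) + 2 ^ j) =
      ∑ k ∈ Finset.Ioo (c * i - i) (c * i), T (2 ^ k + 1) + T (2 ^ (c * i) + 1) := by
    intro c hc
    have hci : i ≤ c * i := Nat.le_mul_of_pos_left i hc
    obtain ⟨d, hd⟩ := Nat.exists_eq_add_of_le hci
    rw [hd, Nat.add_sub_cancel_left, add_comm (∑ k ∈ _, _),
      ← Finset.sum_insert (f := fun k => T (2 ^ k + 1)) (by simp)]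
    refine Finset.sum_nbij' (fun j => i + d - j) (fun k => i + d - k) ?_ ?_ ?_ ?_ ?_
    · intro j hj
      simp only [Finset.mem_range, Finset.mem_insert, Finset.mem_Ioo] at hj ⊢
      omega
    · intro j hj
      simp only [Finset.mem_range, Finset.mem_insert, Finset.mem_Ioo] at hj ⊢
      omega
    · intro j hj
      simp only [Finset.mem_range] at hj
      omega
    · intro j hj
      simp only [Finset.mem_insert, Finset.mem_Ioo] at hj
      omega
    · intro j hj
      rw [Finset.mem_range] at hj
      exact hT.pair (by omega)
  have h4 : ∑ k ∈ Finset.Ioo (4 * i - i) (4 * i), T (2 ^ k + 1) =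
      ∑ k ∈ Finset.Ioo (2 * i - i) (2 * i), T (2 ^ k + 1) := by
    refine Finset.sum_nbij' (fun k => 5 * i - k) (fun k => 5 * i - k) ?_ ?_ ?_ ?_ ?_
    · intro j hj
      simp only [Finset.mem_Ioo] at hj ⊢
      omega
    · intro j hj
      simp only [Finset.mem_Ioo] at hj ⊢
      omega
    · intro j hj
      simp only [Finset.mem_Ioo] at hj
      omega
    · intro j hj
      simp only [Finset.mem_Ioo] at hj
      omega
    · intro j hj
      simp only [Finset.mem_Ioo] at hj
      exact (hT.reflect (by omega)).symm
  have h3 : ∑ k ∈ Finset.Ioo (3 * i - i) (3 * i), T (2 ^ k + 1) = 0 := by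
    refine Finset.sum_involution (fun k _ => 5 * i - k) ?_ ?_ ?_ ?_
    · intro k hk
      simp only [Finset.mem_Ioo] at hk
      rw [hT.reflect (by omega), CharTwo.add_self_eq_zero]
    · intro k hk hne he
      simp only [Finset.mem_Ioo] at hk
      exact hne (hT.half k (by omega))
    · intro k hk
      simp only [Finset.mem_Ioo] at hk ⊢
      omega
    · intro k hk
      simp only [Finset.mem_Ioo] at hk
      omega
  have h5 : T (2 ^ (3 * i) + 1) = T (2 ^ (2 * i) + 1) := by
    rw [← hT.reflect (a := 2 * i) (by omega)]
    congr 3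
    omega
  have h6 : T (2 ^ (4 * i) + 1) = T (2 ^ i + 1) := by
    rw [← hT.reflect (a := i) (by omega)]
    congr 3
    omega
  rw [hre 2 (by omega), hre 3 (by omega), hre 4 (by omega), h3, h4, h5, h6]
  have e1 := CharTwo.add_self_eq_zero (T (2 ^ (2 * i) + 1))
  have e2 := CharTwo.add_self_eq_zero (∑ k ∈ Finset.Ioo (2 * i - i) (2 * i), T (2 ^ k + 1))
  linear_combination e1 + e2

/-- In units of `i` modulo `5`, rotation by `2` takes `{2,3,0}` to `{4,0,2}`, and takes `{3,4,0}` to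
`{0,1,2}` and then to `{2,3,4}`. These identities remove position `0` from `RLower3` and the word
with only the three marks. -/
theorem IsCyclic.triples (hT : IsCyclic i T) :
    T (2 ^ (2 * i) + 2 ^ (3 * i) + 1) = T (2 ^ (2 * i) + 2 ^ (4 * i) + 1) ∧
      T (2 ^ (3 * i) + 2 ^ (4 * i) + 1) = T (2 ^ (2 * i) + 2 ^ (3 * i) + 2 ^ (4 * i)) := by
  have e : ∀ c, 2 ^ (2 * i) * 2 ^ (c * i) = 2 ^ ((c + 2) * i) := by
    intro c
    rw [← pow_add]
    congr 1
    ring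
  have p0 : ∀ y, T (2 ^ (5 * i) + y) = T (1 + y) := fun y => by
    simpa using hT.period 0 y
  have p1 : ∀ y, T (2 ^ (6 * i) + y) = T (2 ^ i + y) := fun y => by
    have := hT.period i y
    rwa [show 5 * i + i = 6 * i by ring] at this
  constructor
  · rw [← hT.two_pow_mul (2 * i), mul_add, mul_add, e 2, e 3, mul_one, add_right_comm, add_comm,
      p0]
    congr 1
    ring
  · rw [← hT.two_pow_mul (2 * i), mul_add, mul_add, e 3, e 4, mul_one, add_assoc, p0, add_left_comm,
      p1, ← hT.two_pow_mul (2 * i), mul_add, mul_add, e 2, mul_one, ← pow_add,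
      show 2 * i + i = 3 * i by ring]
    congr 1
    ring

theorem IsCyclic.sum_eq_sum_R (hT : IsCyclic i T) (hi : 1 ≤ i) :
    ∑ w ∈ (marks i).powerset, ∑ a ∈ (Finset.range i).powerset,
      T (∑ j ∈ w, 2 ^ j + ∑ j ∈ a, 2 ^ j) = ∑ y ∈ R i, T y := by
  have h23 : 2 * i ≠ 3 * i := by omega
  have h24 : 2 * i ≠ 4 * i := by omega
  have h34 : 3 * i ≠ 4 * i := by omega
  have hsplit : Finset.range i = insert 0 (Finset.Ico 1 i) := by
    ext j
    simp only [Finset.mem_range, Finset.mem_insert, Finset.mem_Ico]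
    omega
  have hzero : 0 ∉ Finset.Ico 1 i := by simp
  have hrange : ∀ a ∈ Finset.powersetCard 1 (Finset.range i), a ⊆ Finset.range i :=
    fun a ha => (Finset.mem_powersetCard.1 ha).1
  have hIco : ∀ a ∈ Finset.powersetCard 1 (Finset.Ico 1 i), a ⊆ Finset.range i :=
    fun a ha => (Finset.mem_powersetCard.1 ha).1.trans (by
      rw [hsplit]
      exact Finset.subset_insert _ _)
  have hU2 := sum_blockSet hi (𝒲 := (marks i).powerset.erase ∅)
    (𝒜 := (Finset.range i).powerset.filter fun a => 2 ≤ a.card)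
    (fun w hw => Finset.mem_powerset.1 (Finset.mem_of_mem_erase hw))
    (fun a ha => Finset.mem_powerset.1 (Finset.mem_filter.1 ha).1) T
  have hL4 := sum_blockSet hi (𝒲 := {marks i})
    (fun w hw => (Finset.mem_singleton.1 hw).subset) hrange T
  have hL3 := sum_blockSet hi (𝒲 := Finset.powersetCard 2 (marks i))
    (fun w hw => (Finset.mem_powersetCard.1 hw).1) hIco T
  rw [← RUpper2_eq, sum_powerset_erase_triple h23 h24 h34] at hU2
  rw [← RLower4_eq, Finset.sum_singleton, sum_powersetCard_one] at hL4
  rw [← RLower3_eq, sum_powersetCard_two_triple h23 h24 h34, sum_powersetCard_one,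
    sum_powersetCard_one, sum_powersetCard_one] at hL3
  have hL2 : ∑ y ∈ RLower2 i, T y =
      T (2 ^ (4 * i) + 2 ^ (3 * i)) + T (2 ^ (4 * i) + 2 ^ (2 * i)) := by
    refine Finset.sum_pair fun h => ?_
    have := Nat.pow_right_injective le_rfl (Nat.add_left_cancel h)
    omega
  have hL1 : ∑ y ∈ RLower1 i, T y = if Even i then T 1 else 0 := by
    unfold RLower1
    split_ifs <;> simp
  -- This holds for both parities, as `T 0 = 0` when `i` is even.
  have hL0 : ∑ y ∈ RLower0 i, T y = T 0 := by
    unfold RLower0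
    rw [hT.zero]
    split_ifs with h
    · simp
    · simp [hT.zero, h]
  have hempty : ∑ a ∈ (Finset.range i).powerset, T (∑ j ∈ a, 2 ^ j) = _ :=
    (sum_powerset_range_eq_sum_range i T).trans (sum_range_two_pow_eq hi T hT.two_mul)
  rw [sum_R hi, hU2, hL4, hL3, hL2, hL1, hL0,
    ← Finset.add_sum_erase _ _ (Finset.empty_mem_powerset (marks i)),
    sum_powerset_erase_triple h23 h24 h34]
  simp only [Finset.sum_empty, zero_add]
  rw [hempty]
  -- The three single-mark words each contribute `T 1`; with the leftover from the words below `2^i`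
  -- this is `T 1` for even `i` and `0` for odd `i`, matching `RLower1`.
  have hcase : (if Even i then (0 : ZMod 2) else T 1) = (if Even i then T 1 else 0) + T 1 := by
    split_ifs
    · rw [CharTwo.add_self_eq_zero]
    · rw [zero_add]
  have hpair := hT.sum_pairs hi
  obtain ⟨ht1, ht2⟩ := hT.triples
  have h43 : T (2 ^ (4 * i) + 2 ^ (3 * i)) = T (2 ^ i + 1) := by
    rw [hT.pair (by omega)]
    congr 3
    omega
  have h32 : T (2 ^ (3 * i) + 2 ^ (2 * i)) = T (2 ^ i + 1) := by
    rw [hT.pair (by omega)]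
    congr 3
    omega
  -- The pair `{2i, 3i}` has gap `i`, so it cancels the term left by `sum_pairs`; this is why it is
  -- absent from `RLower2`.
  rw [add_comm] at h32
  simp only [sum_powerset_eq_of_card (Finset.range i), Finset.sum_empty, add_zero,
    Finset.sum_singleton, Finset.sum_pair h23, Finset.sum_pair h24, Finset.sum_pair h34]
  have hmarks : ∑ j ∈ marks i, 2 ^ j = 2 ^ (2 * i) + 2 ^ (3 * i) + 2 ^ (4 * i) := by
    rw [Finset.sum_insert (by simp [h23, h24]), Finset.sum_pair h34, add_assoc]
  have hsum : ∀ z, ∑ x ∈ Finset.range i, T (z + 2 ^ x) =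
      T (z + 1) + ∑ x ∈ Finset.Ico 1 i, T (z + 2 ^ x) := by
    intro z
    rw [hsplit, Finset.sum_insert hzero, pow_zero]
  have c34 : T (2 ^ (3 * i) + 2 ^ (4 * i)) = T (2 ^ (4 * i) + 2 ^ (3 * i)) := by rw [add_comm]
  have c24 : T (2 ^ (2 * i) + 2 ^ (4 * i)) = T (2 ^ (4 * i) + 2 ^ (2 * i)) := by rw [add_comm]
  have h2 : (2 : ZMod 2) = 0 := rfl
  rw [hcase, hmarks, hT.two_pow, hT.two_pow, hT.two_pow]
  linear_combination hpair + h32 + ht1 + ht2 + c34 + c24 + hsum (2 ^ (2 * i) + 2 ^ (3 * i)) +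
    hsum (2 ^ (2 * i) + 2 ^ (4 * i)) + hsum (2 ^ (3 * i) + 2 ^ (4 * i)) +
    h2 * (2 * T 1 + T (2 ^ i + 1) + T (2 ^ (2 * i) + 2 ^ (4 * i) + 1) +
      T (2 ^ (2 * i) + 2 ^ (3 * i) + 2 ^ (4 * i)))

end Cyclic

/-! ### The cardinality of `R i`. -/

theorem zero_mem_R {i : ℕ} (hi : 1 ≤ i) : 0 ∈ R i ↔ ¬ Even i := by
  have hW : (ones i (5 * i) 0).card = 0 := by simp [ones]
  have hA : (ones 0 i 0).card = 0 := by simp [ones]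
  constructor
  · intro h
    rcases mem_R.1 h with h | h | h | h | h | h | h
    · have := card_ones_of_mem_RUpper1 h
      omega
    · have := card_ones_of_mem_RUpper2 h
      omega
    · have := card_ones_of_mem_RLower4 hi h
      omega
    · have := card_ones_of_mem_RLower3 h
      omega
    · have := card_ones_of_mem_RLower2 hi h
      omega
    · have := card_ones_of_mem_RLower1 hi h
      omega
    · unfold RLower0 at h
      split_ifs at h with h'
      · simp at h
      · exact h'
  · intro h
    rw [mem_R]
    simp [RLower0, h]

/-- Besides `RUpper1`, the pieces contribute `7(2^i - 1 - i)`, `i`, `3(i - 1)`, `2`, and one element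
from `RLower1` or `RLower0`. -/
theorem three_mul_card_R {i : ℕ} (hi : 1 ≤ i) :
    3 * (R i).card + 9 * i + (if Even i then 22 else 23) = 22 * 2 ^ i := by
  have h23 : 2 * i ≠ 3 * i := by omega
  have h24 : 2 * i ≠ 4 * i := by omega
  have h34 : 3 * i ≠ 4 * i := by omega
  have hU2 := sum_blockSet hi (𝒲 := (marks i).powerset.erase ∅)
    (𝒜 := (Finset.range i).powerset.filter fun a => 2 ≤ a.card)
    (fun w hw => Finset.mem_powerset.1 (Finset.mem_of_mem_erase hw))
    (fun a ha => Finset.mem_powerset.1 (Finset.mem_filter.1 ha).1) (fun _ => 1)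
  have hL4 := sum_blockSet hi (𝒲 := {marks i}) (𝒜 := Finset.powersetCard 1 (Finset.range i))
    (fun w hw => (Finset.mem_singleton.1 hw).subset)
    (fun a ha => (Finset.mem_powersetCard.1 ha).1) (fun _ => 1)
  have hL3 := sum_blockSet hi (𝒲 := Finset.powersetCard 2 (marks i))
    (𝒜 := Finset.powersetCard 1 (Finset.Ico 1 i)) (fun w hw => (Finset.mem_powersetCard.1 hw).1)
    (fun a ha => (Finset.mem_powersetCard.1 ha).1.trans fun j hj =>
      Finset.mem_range.2 (Finset.mem_Ico.1 hj).2) (fun _ => 1)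
  have hN := sum_powerset_eq_of_card (Finset.range i) (fun _ => 1)
  have hR := sum_R hi (fun _ => 1)
  have hL2 : (RLower2 i).card = 2 := by
    refine Finset.card_pair fun h => ?_
    have := Nat.pow_right_injective le_rfl (Nat.add_left_cancel h)
    omega
  have hU1 := three_mul_card_RUpper1 hi
  rw [← RUpper2_eq, sum_powerset_erase_triple h23 h24 h34] at hU2
  rw [← RLower4_eq, Finset.sum_singleton, sum_powersetCard_one] at hL4
  rw [← RLower3_eq, sum_powersetCard_two_triple h23 h24 h34, sum_powersetCard_one] at hL3
  simp only [← Finset.card_eq_sum_ones, Finset.card_range, Finset.card_powerset,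
    Nat.card_Ico] at hU2 hL4 hL3 hN hR
  by_cases h : Even i
  · have hL1 : (RLower1 i).card = 1 := by simp [RLower1, h]
    have hL0 : (RLower0 i).card = 0 := by simp [RLower0, h]
    rw [if_pos h] at hU1 ⊢
    omega
  · have hL1 : (RLower1 i).card = 0 := by simp [RLower1, h]
    have hL0 : (RLower0 i).card = 1 := by simp [RLower0, h]
    rw [if_neg h] at hU1 ⊢
    omega

/-! ### Traces, conjugates and minimal polynomials in the finite field. -/

section Field

variable {i : ℕ} {F : Type*} [Field F] [Finite F] [Algebra (ZMod 2) F]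

theorem finrank_eq {m : ℕ} (hF : Nat.card F = 2 ^ m) : Module.finrank (ZMod 2) F = m := by
  have h := Module.natCard_eq_pow_finrank (K := ZMod 2) (V := F)
  rw [hF, Nat.card_zmod] at h
  exact (Nat.pow_right_injective le_rfl h).symm

theorem pow_two_pow {F : Type*} [Field F] [Finite F] {m : ℕ} (hF : Nat.card F = 2 ^ m) (x : F) :
    x ^ 2 ^ m = x := by
  have := Fintype.ofFinite F
  rw [← hF, Nat.card_eq_fintype_card, FiniteField.pow_card]

theorem algebraMap_trace_eq {m : ℕ} (hF : Nat.card F = 2 ^ m) (x : F) :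
    algebraMap (ZMod 2) F (Algebra.trace (ZMod 2) F x) = ∑ r ∈ Finset.range m, x ^ 2 ^ r := by
  rw [FiniteField.algebraMap_trace_eq_sum_pow, finrank_eq hF, Nat.card_zmod]

theorem isCyclic_trace (hF : Nat.card F = 2 ^ (5 * i)) (x : F) :
    IsCyclic i fun y => Algebra.trace (ZMod 2) F (x ^ y) := by
  have : CharP F 2 := charP_of_injective_algebraMap (algebraMap (ZMod 2) F).injective 2
  refine ⟨fun y => ?_, fun k y => ?_, ?_, fun k hk => ?_⟩
  · have h := Algebra.trace_eq_of_algEquiv (FiniteField.frobeniusAlgEquivOfAlgebraic (ZMod 2) F)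
      (x ^ y)
    rw [← h]
    simp [← pow_mul, mul_comm]
  · rw [pow_add x, pow_add 2, pow_mul x, pow_two_pow hF, ← pow_add]
  · rw [pow_zero, ← map_one (algebraMap (ZMod 2) F), Algebra.trace_algebraMap, finrank_eq hF]
    rw [nsmul_one]
    split_ifs with h
    · exact (ZMod.natCast_eq_zero_iff_even).2 (h.mul_left 5)
    · exact (ZMod.natCast_eq_one_iff_odd).2 (Odd.mul (by decide) (Nat.not_even_iff_odd.1 h))
  · apply (algebraMap (ZMod 2) F).injective
    rw [algebraMap_trace_eq hF, map_zero, ← hk, two_mul, Finset.sum_range_add]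
    rw [← Finset.sum_add_distrib]
    refine Finset.sum_eq_zero fun r _ => ?_
    -- With `5i = 2k`, this element is fixed by the `k`-th power of Frobenius, so the two halves of
    -- its trace coincide and cancel.
    have h : (x ^ (2 ^ k + 1)) ^ 2 ^ k = x ^ (2 ^ k + 1) := by
      rw [← pow_mul, add_mul, one_mul, ← pow_add, ← two_mul, hk, pow_add, pow_two_pow hF,
        pow_succ, mul_comm]
    rw [pow_add 2 k r, pow_mul _ (2 ^ k), h, CharTwo.add_self_eq_zero]

theorem one_add_pow_dobbertinExp {F : Type*} [Field F] [Algebra (ZMod 2) F] (hi : 1 ≤ i) (x : F) :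
    (1 + x) ^ dobbertinExp i =
    ∑ w ∈ (marks i).powerset, ∑ a ∈ (Finset.range i).powerset,
      x ^ (∑ j ∈ w, 2 ^ j + ∑ j ∈ a, 2 ^ j) := by
  have : CharP F 2 := charP_of_injective_algebraMap (algebraMap (ZMod 2) F).injective 2
  have hexp : dobbertinExp i = ∑ j ∈ marks i, 2 ^ j + ∑ j ∈ Finset.range i, 2 ^ j := by
    have hgeom : ∀ n, ∑ j ∈ Finset.range n, 2 ^ j + 1 = 2 ^ n := by
      intro n
      induction n with
      | zero => rfl
      | succ n ih =>
        rw [Finset.sum_range_succ, pow_succ]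
        omega
    rw [Finset.sum_insert, Finset.sum_pair (by omega)]
    · have := hgeom i
      have := Nat.one_le_two_pow (n := 2 * i)
      have := Nat.one_le_two_pow (n := 3 * i)
      have := Nat.one_le_two_pow (n := 4 * i)
      unfold dobbertinExp
      omega
    · simp only [Finset.mem_insert, Finset.mem_singleton]
      omega
  have hprod : ∀ s : Finset ℕ, (1 + x) ^ (∑ j ∈ s, 2 ^ j) =
      ∑ t ∈ s.powerset, x ^ (∑ j ∈ t, 2 ^ j) := by
    intro s
    rw [← Finset.prod_pow_eq_pow_sum]
    simp_rw [add_pow_char_pow, one_pow, Finset.prod_one_add, Finset.prod_pow_eq_pow_sum]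
  rw [hexp, pow_add, hprod, hprod, Finset.sum_mul_sum]
  simp_rw [pow_add]

theorem dobbertinSeq_eq (hi : 1 ≤ i) (hF : Nat.card F = 2 ^ (5 * i)) (α : F) (t : ℕ) :
    dobbertinSeq i α t = ∑ y ∈ R i, Algebra.trace (ZMod 2) F ((α ^ t) ^ y) := by
  rw [← (isCyclic_trace hF (α ^ t)).sum_eq_sum_R hi, dobbertinSeq, one_add_pow_dobbertinExp hi,
    map_sum]
  simp_rw [map_sum]

theorem aeval_pow_two_pow {F : Type*} [Field F] [Algebra (ZMod 2) F] (c : (ZMod 2)[X]) (x : F) (r : ℕ) :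
    aeval (x ^ 2 ^ r) c = aeval x c ^ 2 ^ r := by
  induction r with
  | zero => rw [pow_zero, pow_one, pow_one]
  | succ r ih =>
    rw [pow_succ, pow_mul, pow_mul, ← ih, ← map_pow, ← ZMod.expand_card, expand_aeval]

/-- Elements with the same minimal polynomial are Galois conjugate, and the Galois group consists of
powers of Frobenius. -/
theorem exists_pow_of_minpoly_eq {m : ℕ} (hF : Nat.card F = 2 ^ m) {x y : F}
    (h : minpoly (ZMod 2) x = minpoly (ZMod 2) y) : ∃ r < m, y = x ^ 2 ^ r := by
  obtain ⟨σ, rfl⟩ := (isConjRoot_iff_exists_algEquiv (K := ZMod 2) (x := y) (y := x)).1 h.symm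
  obtain ⟨r, rfl⟩ := (FiniteField.bijective_frobeniusAlgEquivOfAlgebraic_pow (ZMod 2) F).2 σ
  refine ⟨r, finrank_eq hF ▸ r.2, ?_⟩
  simp only [AlgEquiv.coe_pow, FiniteField.coe_frobeniusAlgEquivOfAlgebraic_iterate, ZMod.card]

/-- The size of the cyclotomic coset of `k`, for `k` in `R i`. -/
def cosetSize (i k : ℕ) : ℕ := if k = 0 then 1 else 5 * i

theorem pow_mul_two_pow_injOn {F : Type*} [Field F] (hi : 1 ≤ i) {α : F}
    (hα : orderOf α = 2 ^ (5 * i) - 1)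
    {k k' r r' : ℕ} (hk : k ∈ R i) (hk' : k' ∈ R i) (hr : r < cosetSize i k)
    (hr' : r' < cosetSize i k') (h : α ^ (k * 2 ^ r) = α ^ (k' * 2 ^ r')) : k = k' ∧ r = r' := by
  have key : ∀ k ∈ R i, ∀ r, k ≠ 0 → α ^ (k * 2 ^ r) ≠ 1 := by
    intro k hk r hk0 h1
    rw [← orderOf_dvd_iff_pow_eq_one, hα] at h1
    have := Nat.le_of_dvd (by omega)
      ((coprime_two_pow_sub_one_two_pow (by omega) r).dvd_of_dvd_mul_right h1)
    have := mem_St.1 (mem_St_of_mem_R hi hk)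
    omega
  unfold cosetSize at hr hr'
  by_cases hk0 : k = 0 <;> by_cases hk0' : k' = 0
  · rw [if_pos hk0] at hr
    rw [if_pos hk0'] at hr'
    omega
  · rw [hk0, zero_mul, pow_zero] at h
    exact absurd h.symm (key k' hk' r' hk0')
  · rw [hk0', zero_mul, pow_zero] at h
    exact absurd h (key k hk r hk0)
  · rw [if_neg hk0] at hr
    rw [if_neg hk0'] at hr'
    have hpos : 0 < orderOf α := by
      have := Nat.pow_le_pow_right two_pos (show 1 ≤ 5 * i by omega)
      omega
    have hmod := (orderOf_pos_iff.1 hpos).pow_eq_pow_iff_modEq.1 h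
    rw [hα] at hmod
    exact (eq_of_mul_two_pow_modEq hi hr' hr hk' hk0' hk hk0 hmod).symm

theorem minpoly_inv_injOn (hi : 1 ≤ i) (hF : Nat.card F = 2 ^ (5 * i)) {α : F}
    (hα : orderOf α = 2 ^ (5 * i) - 1) {k k' : ℕ} (hk : k ∈ R i) (hk' : k' ∈ R i)
    (h : minpoly (ZMod 2) (α ^ k)⁻¹ = minpoly (ZMod 2) (α ^ k')⁻¹) : k = k' := by
  obtain ⟨r, hr, h⟩ := exists_pow_of_minpoly_eq hF h
  rw [inv_pow, inv_inj, ← pow_mul] at h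
  by_cases hk0 : k = 0
  · subst hk0
    rw [zero_mul] at h
    refine (pow_mul_two_pow_injOn hi hα (r := 0) (r' := 0) hk hk' ?_ ?_ ?_).1
    · unfold cosetSize; split_ifs <;> omega
    · unfold cosetSize; split_ifs <;> omega
    · rw [zero_mul, pow_zero, pow_zero, mul_one, h, pow_zero]
  · refine (pow_mul_two_pow_injOn hi hα (r := r) (r' := 0) hk hk' ?_ ?_ ?_).1
    · rwa [cosetSize, if_neg hk0]
    · unfold cosetSize; split_ifs <;> omega
    · rw [pow_zero, mul_one, h]

/-- For `k ≠ 0` the field degree bounds it above, and the `5i` distinct conjugates are roots. -/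
theorem natDegree_minpoly_inv (hi : 1 ≤ i) (hF : Nat.card F = 2 ^ (5 * i)) {α : F}
    (hα : orderOf α = 2 ^ (5 * i) - 1) {k : ℕ} (hk : k ∈ R i) :
    (minpoly (ZMod 2) (α ^ k)⁻¹).natDegree = cosetSize i k := by
  classical
  by_cases hk0 : k = 0
  · rw [hk0, pow_zero, inv_one, minpoly.one, cosetSize, if_pos rfl]
    exact natDegree_X_sub_C 1
  have hint : IsIntegral (ZMod 2) (α ^ k)⁻¹ := Algebra.IsIntegral.isIntegral _
  refine le_antisymm ?_ ?_
  · rw [cosetSize, if_neg hk0]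
    exact (minpoly.natDegree_le _).trans (finrank_eq hF).le
  · have hne : (minpoly (ZMod 2) (α ^ k)⁻¹).map (algebraMap (ZMod 2) F) ≠ 0 :=
      ((minpoly.monic hint).map _).ne_zero
    have hsub : (Finset.range (cosetSize i k)).image (fun r => (α ^ (k * 2 ^ r))⁻¹) ⊆
        ((minpoly (ZMod 2) (α ^ k)⁻¹).map (algebraMap (ZMod 2) F)).roots.toFinset := by
      intro β hβ
      obtain ⟨r, -, rfl⟩ := Finset.mem_image.1 hβ
      rw [Multiset.mem_toFinset, mem_roots hne, IsRoot.def, eval_map_algebraMap, pow_mul,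
        ← inv_pow, aeval_pow_two_pow, minpoly.aeval, zero_pow (by positivity)]
    have hcard := Finset.card_le_card hsub
    rw [Finset.card_image_of_injOn, Finset.card_range] at hcard
    · refine hcard.trans ((Multiset.toFinset_card_le _).trans ((card_roots' _).trans ?_))
      exact natDegree_map_le
    · intro r hr r' hr' h
      exact (pow_mul_two_pow_injOn hi hα hk hk (Finset.mem_range.1 hr) (Finset.mem_range.1 hr')
        (inv_injective h)).2

theorem isLinearSpan_dobbertinSeq (hi : 1 ≤ i) (hF : Nat.card F = 2 ^ (5 * i)) {α : F}
    (hα : orderOf α = 2 ^ (5 * i) - 1) :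
    IsLinearSpan (dobbertinSeq i α) (∑ k ∈ R i, cosetSize i k) ∧
      IsMinimalPolynomial (dobbertinSeq i α) (∏ k ∈ R i, minpoly (ZMod 2) (α ^ k)⁻¹) := by
  classical
  have hα0 : α ≠ 0 := by
    rintro rfl
    rw [orderOf_zero] at hα
    have := Nat.pow_le_pow_right two_pos (show 5 ≤ 5 * i by omega)
    omega
  rw [← Finset.sum_congr rfl fun k hk => natDegree_minpoly_inv hi hF hα hk]
  -- The witness for nonemptiness comes from `RLower2`, which does not depend on the parity of `i`.
  -- The set `J` consists of all conjugates of all `α^k`.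
  refine isLinearSpan_prod_minpoly (R i) ⟨2 ^ (4 * i) + 2 ^ (3 * i), ?_⟩ (fun k => (α ^ k)⁻¹)
    (fun k _ => inv_ne_zero (pow_ne_zero _ hα0))
    (fun k hk k' hk' h => minpoly_inv_injOn hi hF hα hk hk' h)
    (((R i).sigma fun k => Finset.range (cosetSize i k)).image fun p => α ^ (p.1 * 2 ^ p.2))
    ?_ _ ?_ ?_
  · rw [mem_R]
    simp [RLower2]
  · intro β hβ
    obtain ⟨p, -, rfl⟩ := Finset.mem_image.1 hβ
    exact pow_ne_zero _ hα0
  · intro t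
    rw [dobbertinSeq_eq hi hF, map_sum, Finset.sum_image, Finset.sum_sigma]
    · refine Finset.sum_congr rfl fun k hk => ?_
      dsimp only
      by_cases hk0 : k = 0
      · subst hk0
        have h0 := (isCyclic_trace hF (α ^ t)).zero
        rw [if_neg ((zero_mem_R hi).1 hk)] at h0
        rw [h0, cosetSize, if_pos rfl]
        simp
      · rw [algebraMap_trace_eq hF, cosetSize, if_neg hk0]
        refine Finset.sum_congr rfl fun r _ => ?_
        rw [← pow_mul, ← pow_mul, ← pow_mul]
        congr 1
        ring
    · rintro ⟨k, r⟩ hp ⟨k', r'⟩ hp' h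
      simp only [Finset.coe_sigma, Set.mem_sigma_iff, Finset.mem_coe, Finset.mem_range] at hp hp'
      obtain ⟨rfl, rfl⟩ := pow_mul_two_pow_injOn hi hα hp.1 hp'.1 hp.2 hp'.2 h
      rfl
  · intro c
    constructor
    · intro h k hk
      refine h (α ^ k) (Finset.mem_image.2 ⟨⟨k, 0⟩, ?_, by simp⟩)
      simp only [Finset.mem_sigma, Finset.mem_range, cosetSize]
      refine ⟨hk, ?_⟩
      split_ifs <;> omega
    · intro h β hβ
      obtain ⟨⟨k, r⟩, hp, rfl⟩ := Finset.mem_image.1 hβ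
      dsimp only
      rw [pow_mul, ← inv_pow, aeval_pow_two_pow, h k (Finset.mem_sigma.1 hp).1,
        zero_pow (by positivity)]

end Field

end DobbertinSequence

theorem mainTheorem3 (i m : ℕ) (hi : 1 ≤ i) (hm : m = 5 * i)
    (F : Type*) [Field F] [Finite F] [Algebra (ZMod 2) F] (hF : Nat.card F = 2 ^ m)
    (α : Fˣ) (hα : ∀ x : Fˣ, x ∈ Subgroup.zpowers α) :
    (∃ L : ℕ, DobbertinSequence.IsLinearSpan (DobbertinSequence.dobbertinSeq i (α : F)) L ∧
      (Even i → (L : ℚ) = m * (22 / 3 * (2 ^ i - 1) - 3 * i)) ∧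
      (Odd i → (L : ℚ) = m * (22 / 3 * (2 ^ i - 2) - 3 * i + 6) + 1)) ∧
    (Even i → DobbertinSequence.IsMinimalPolynomial (DobbertinSequence.dobbertinSeq i (α : F))
      (∏ k ∈ DobbertinSequence.R i, minpoly (ZMod 2) (((α : F) ^ k)⁻¹))) ∧
    (Odd i → DobbertinSequence.IsMinimalPolynomial (DobbertinSequence.dobbertinSeq i (α : F))
      ((X - 1) * ∏ k ∈ (DobbertinSequence.R i).erase 0,
        minpoly (ZMod 2) (((α : F) ^ k)⁻¹))) := by
  subst hm
  have hord : orderOf (α : F) = 2 ^ (5 * i) - 1 := by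
    rw [orderOf_units, orderOf_eq_card_of_forall_mem_zpowers hα, Nat.card_units, hF]
  obtain ⟨hspan, hmin⟩ := DobbertinSequence.isLinearSpan_dobbertinSeq hi hF hord
  have hcard := DobbertinSequence.three_mul_card_R hi
  have hzero := DobbertinSequence.zero_mem_R hi
  have hsize : ∀ k ∈ (DobbertinSequence.R i).erase 0, DobbertinSequence.cosetSize i k = 5 * i :=
    fun k hk => if_neg (Finset.ne_of_mem_erase hk)
  refine ⟨⟨_, hspan, fun h => ?_, fun h => ?_⟩, fun _ => hmin, fun h => ?_⟩
  · rw [if_pos h] at hcard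
    have h0 : 0 ∉ DobbertinSequence.R i := fun h' => hzero.1 h' h
    rw [Finset.erase_eq_of_notMem h0] at hsize
    rw [Finset.sum_congr rfl hsize, Finset.sum_const, smul_eq_mul]
    have hq : (3 * (DobbertinSequence.R i).card + 9 * i + 22 : ℚ) = 22 * 2 ^ i := by
      exact_mod_cast hcard
    push_cast
    linear_combination (5 * i / 3 : ℚ) * hq
  · have hne := Nat.not_even_iff_odd.2 h
    rw [if_neg hne] at hcard
    have h0 := hzero.2 hne
    -- For odd `i` the exponent `0` is split off: it has degree `1`, the final `+ 1` of the formula,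
    -- and every other exponent contributes `5i`.
    rw [← Finset.add_sum_erase _ _ h0, Finset.sum_congr rfl hsize, Finset.sum_const, smul_eq_mul]
    rw [← Finset.card_erase_add_one h0] at hcard
    have hq : (3 * (((DobbertinSequence.R i).erase 0).card + 1) + 9 * i + 23 : ℚ) = 22 * 2 ^ i := by
      exact_mod_cast hcard
    rw [DobbertinSequence.cosetSize, if_pos rfl]
    push_cast
    linear_combination (5 * i / 3 : ℚ) * hq
  · rw [← Finset.mul_prod_erase _ _ (hzero.2 (Nat.not_even_iff_odd.2 h)), pow_zero, inv_one,
      minpoly.one] at hmin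
    exact hmin
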